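/- Let $X$ be an integral scheme which is smooth and proper over $\mathbb{C}$ (for instance a connected smooth projective variety), let $V$ be a finite dimensional complex vector space, and let $G\subset \mathrm{SL}(V)$ be a reductive algebraic subgroup. Let $\kappa\colon \mathrm{GL}(V)\to \mathrm{GL}(W)$ be a finite dimensional rational representation and $w_0\in W\setminus\{0\}$ a point such that the $\mathrm{SL}(V)$-stabilizer of $w_0$ is $G$, the orbit $\mathrm{SL}(V)\cdot w_0\cong \mathrm{SL}(V)/G$ is Zariski closed in $W$, and $\mathbb{C}^*=\mathbb{C}^*\cdot \mathrm{id}_V$ acts on $W$ with positive weights only. Let $\widetilde{G}\subset \mathrm{GL}(V)$ be the $\mathrm{GL}(V)$-stabilizer of $w_0$. A singular principal $\widetilde{G}$-bundle on $X$ is a pair $(\mathcal{A},\widetilde{\tau})$ which consists of a coherent torsion free sheaf $\mathcal{A}$ on $X$ of rank $\dim V$ with $\det(\mathcal{A})=(\bigwedge^{\dim V}\mathcal{A})^{\vee\vee}\cong\mathcal{O}_X$ and a homomorphism $\widetilde{\tau}\colon \mathrm{Sym}^*(V\otimes\mathcal{A})^{\widetilde{G}}\to\mathcal{O}_X$ of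 $\mathcal{O}_X$-algebras for which the induced section $X\to \underline{\mathrm{Spec}}(\mathrm{Sym}^*(V\otimes\mathcal{A})^{\widetilde{G}})$ is not the zero section. Let $(\mathcal{A},\widetilde{\tau})$ be a singular principal $\widetilde{G}$-bundle on $X$, let $U$ be the maximal open subset of $X$ on which $\mathcal{A}$ is locally free, and let $$\widetilde{\sigma}\colon U\to \underline{\mathrm{Hom}}(V\otimes\mathcal{O}_U,\mathcal{A}^\vee_{|U})/\!/\widetilde{G}=\underline{\mathrm{Spec}}\bigl(\mathrm{Sym}^*(V\otimes\mathcal{A}_{|U})^{\widetilde{G}}\bigr)$$ be the section defined by $\widetilde{\tau}_{|U}$. Let $\underline{\mathrm{Isom}}(V\otimes\mathcal{O}_U,\mathcal{A}^\vee_{|U})/\widetilde{G}$ be the image of $\underline{\mathrm{Isom}}(V\otimes\mathcal{O}_U,\mathcal{A}^\vee_{|U})$ under the quotient map. Then either $\widetilde{\sigma}(x)\in \underline{\mathrm{Isom}}(V\otimes\mathcal{O}_U,\mathcal{A}^\vee_{|U})/\widetilde{G}$ for all $x\in U$, or $\widetilde{\sigma}(x)\notin \underline{\mathrm{Isom}}(V\otimes\mathcal{O}_U,\mathcal{A}^\vee_{|U})/\widetilde{G}$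 for all $x\in U$. -/

import Mathlib

open AlgebraicGeometry CategoryTheory
open scoped TensorProduct

noncomputable section

namespace SingularBundle

/-! ### Algebraic groups inside `GL(V)` -/

section Groups

variable (V : Type) [AddCommGroup V] [Module ℂ V]

/-- The polynomial functions on a vector space: the algebra generated by the linear forms. -/
def polynomialFunctions : Subalgebra ℂ (V → ℂ) :=
  Algebra.adjoin ℂ {p | ∃ ξ : Module.Dual ℂ V, p = fun v => ξ v}

/-- The regular functions on `GL(V)`: the algebra generated by the matrix coefficients of `g` and
of `g⁻¹`. -/
def regularFunctions : Subalgebra ℂ ((V ≃ₗ[ℂ] V) → ℂ) :=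
  Algebra.adjoin ℂ
    ({p | ∃ (ξ : Module.Dual ℂ V) (v : V), p = fun g => ξ (g v)} ∪
      {p | ∃ (ξ : Module.Dual ℂ V) (v : V), p = fun g => ξ (g⁻¹ v)})

variable {V}

/-- Zariski closed subsets of a vector space. -/
def IsZariskiClosed (S : Set V) : Prop :=
  ∃ P : Set (V → ℂ), P ⊆ polynomialFunctions V ∧ S = {v | ∀ p ∈ P, p v = 0}

/-- A subgroup of `GL(V)` is algebraic if it is Zariski closed in `GL(V)`. -/
def IsAlgebraicSubgroup (H : Subgroup (V ≃ₗ[ℂ] V)) : Prop :=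
  ∃ P : Set ((V ≃ₗ[ℂ] V) → ℂ), P ⊆ regularFunctions V ∧
    (H : Set (V ≃ₗ[ℂ] V)) = {g | ∀ p ∈ P, p g = 0}

/-- A representation of `GL(V)` is rational if its matrix coefficients are regular functions. -/
def IsRationalRep {W : Type} [AddCommGroup W] [Module ℂ W]
    (κ : Representation ℂ (V ≃ₗ[ℂ] V) W) : Prop :=
  ∀ (ξ : Module.Dual ℂ W) (w : W), (fun g => ξ (κ g w)) ∈ regularFunctions V

/-- A representation of an algebraic subgroup `H` of `GL(V)` is rational if its matrix coefficients
are regular functions on `H`, i.e. restrictions of regular functions on `GL(V)`. -/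
def IsRationalRepOf (H : Subgroup (V ≃ₗ[ℂ] V)) {E : Type} [AddCommGroup E] [Module ℂ E]
    (π : Representation ℂ H E) : Prop :=
  ∀ (ξ : Module.Dual ℂ E) (e : E), ∃ p ∈ regularFunctions V, ∀ h : H, ξ (π h e) = p h

/-- Reductive complex algebraic groups `G ⊆ GL(V)`: every finite dimensional rational
representation of `G` is completely reducible. -/
def IsReductive (G : Subgroup (V ≃ₗ[ℂ] V)) : Prop :=
  IsAlgebraicSubgroup G ∧
    ∀ (E : Type) [AddCommGroup E] [Module ℂ E] [FiniteDimensional ℂ E]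
      (π : Representation ℂ G E), IsRationalRepOf G π →
      ∀ F : Submodule ℂ E, (∀ g, F ≤ F.comap (π g)) →
        ∃ F' : Submodule ℂ E, (∀ g, F' ≤ F'.comap (π g)) ∧ IsCompl F F'

/-- The rational representation `κ : GL(V) → GL(W)` and the point `w₀ = [e] ∈ W` attached to a
subgroup `G ⊆ SL(V)`: acting on `w₀` induces an `SL(V)`-equivariant closed embedding
`SL(V)/G ↪ W` which does not meet the origin, and `ℂ^* = ℂ^* · id_V` acts on `W` with positive
weights only. -/
structure IsOrbitEmbedding (G : Subgroup (V ≃ₗ[ℂ] V)) {W : Type} [AddCommGroup W] [Module ℂ W]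
    (κ : Representation ℂ (V ≃ₗ[ℂ] V) W) (w₀ : W) : Prop where
  rational : IsRationalRep κ
  stabilizer : ∀ g : V ≃ₗ[ℂ] V,
    g ∈ G ↔ LinearMap.det (g : V →ₗ[ℂ] V) = 1 ∧ κ g w₀ = w₀
  closed : IsZariskiClosed
    {w : W | ∃ g : V ≃ₗ[ℂ] V, LinearMap.det (g : V →ₗ[ℂ] V) = 1 ∧ w = κ g w₀}
  ne_zero : w₀ ≠ 0
  weights_pos : Submodule.span ℂ
    {w : W | ∃ n : ℕ, 0 < n ∧ ∀ z : ℂˣ, κ (LinearEquiv.smulOfUnit z) w = (z : ℂ) ^ n • w} = ⊤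

/-- The group `G̃`: the stabilizer of `w₀` in `GL(V)`. -/
def stabilizerGL {W : Type} [AddCommGroup W] [Module ℂ W]
    (κ : Representation ℂ (V ≃ₗ[ℂ] V) W) (w₀ : W) : Subgroup (V ≃ₗ[ℂ] V) where
  carrier := {g | κ g w₀ = w₀}
  mul_mem' {a b} ha hb := by
    simp only [Set.mem_ofPred_eq] at ha hb ⊢
    rw [map_mul, Module.End.mul_apply, hb, ha]
  one_mem' := by simp
  inv_mem' {a} ha := by
    simp only [Set.mem_ofPred_eq] at ha ⊢
    conv_lhs => rw [← ha]
    rw [← Module.End.mul_apply, ← map_mul, inv_mul_cancel, map_one, Module.End.one_apply]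

end Groups

/-! ### The affine local picture

For a `ℂ`-algebra `R` and an `R`-module `M` we write `V ⊗ M` as `(R ⊗[ℂ] V) ⊗[R] M`. If `M` is
locally free of finite rank, `Spec (Sym^*(V ⊗ M))` is the bundle `Hom(V ⊗ O, M^∨)` over `Spec R`,
and `Spec (Sym^*(V ⊗ M)^H)` is its quotient `Hom(V ⊗ O, M^∨) // H`. -/

section Affine

variable (R : Type) [CommRing R] [Algebra ℂ R]
variable (V : Type) [AddCommGroup V] [Module ℂ V]
variable (M : Type) [AddCommGroup M] [Module R M]

/-- The algebra `Sym^*(V ⊗ M)`. -/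
abbrev HomAlg : Type := SymmetricAlgebra R ((R ⊗[ℂ] V) ⊗[R] M)

variable {R V M}

/-- The generator `v ⊗ m` of `Sym^*(V ⊗ M)`. -/
def gen (v : V) (m : M) : HomAlg R V M :=
  SymmetricAlgebra.ι R _ (((1 : R) ⊗ₜ[ℂ] v) ⊗ₜ[R] m)

variable (R M) in
/-- The action of `g ∈ GL(V)` on `Sym^*(V ⊗ M)`, induced by `v ⊗ m ↦ g v ⊗ m`. -/
def glAct (g : V ≃ₗ[ℂ] V) : HomAlg R V M →ₐ[R] HomAlg R V M :=
  SymmetricAlgebra.lift ((SymmetricAlgebra.ι R _).comp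
    (TensorProduct.map ((g : V →ₗ[ℂ] V).baseChange R) LinearMap.id))

lemma glAct_gen (g : V ≃ₗ[ℂ] V) (v : V) (m : M) :
    glAct R M g (gen v m) = gen (g v) m := by
  simp [glAct, gen]

variable (R M) in
/-- The algebra of invariants `Sym^*(V ⊗ M)^H`. -/
def invariants (H : Subgroup (V ≃ₗ[ℂ] V)) : Subalgebra R (HomAlg R V M) where
  carrier := {p | ∀ g ∈ H, glAct R M g p = p}
  mul_mem' ha hb g hg := by rw [map_mul, ha g hg, hb g hg]
  add_mem' ha hb g hg := by rw [map_add, ha g hg, hb g hg]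
  algebraMap_mem' r g _ := by rw [AlgHom.commutes]

/-- The fibre `V ⊗ κ(q) → Hom_R(M, κ(q))`, `v ↦ (m ↦ (v ⊗ m)(q))`, of the universal homomorphism
`V ⊗ O → h^* M^∨` at a point `q` of `h : Spec (Sym^*(V ⊗ M)) → Spec R`. For `M` locally free of
finite rank, `Hom_R(M, κ(q))` is the fibre of `h^* M^∨` at `q`. -/
def universalHom (q : PrimeSpectrum (HomAlg R V M)) :
    q.asIdeal.ResidueField ⊗[R] (R ⊗[ℂ] V) →ₗ[q.asIdeal.ResidueField]
      (M →ₗ[R] q.asIdeal.ResidueField) :=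
  LinearMap.liftBaseChange q.asIdeal.ResidueField
    (TensorProduct.curry
      ((IsScalarTower.toAlgHom R (HomAlg R V M) q.asIdeal.ResidueField).toLinearMap.comp
        (SymmetricAlgebra.ι R ((R ⊗[ℂ] V) ⊗[R] M))))

lemma universalHom_tmul (q : PrimeSpectrum (HomAlg R V M)) (v : V) (m : M) :
    universalHom q (1 ⊗ₜ (1 ⊗ₜ v)) m = algebraMap (HomAlg R V M) _ (gen v m) := by
  simp [universalHom, gen]

variable (R V M) in
/-- The points of `Isom(V ⊗ O, M^∨) ⊆ Hom(V ⊗ O, M^∨)`: those at which the universal homomorphism is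
an isomorphism. -/
def isomLocus : Set (PrimeSpectrum (HomAlg R V M)) :=
  {q | Function.Bijective (universalHom q)}

variable (R M) in
/-- `Isom(V ⊗ O, M^∨)/H`, the image of `Isom(V ⊗ O, M^∨)` under the quotient map
`Hom(V ⊗ O, M^∨) → Hom(V ⊗ O, M^∨) // H`. -/
def isomQuotient (H : Subgroup (V ≃ₗ[ℂ] V)) : Set (PrimeSpectrum (invariants R M H)) :=
  PrimeSpectrum.comap (invariants R M H).val.toRingHom '' isomLocus R V M

variable {R' : Type} [CommRing R'] [Algebra ℂ R']
variable {M' : Type} [AddCommGroup M'] [Module R' M']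

/-- The ring homomorphism `Sym^*(V ⊗ M) → Sym^*(V ⊗ M')` induced by `R → R'` and a semilinear map
`M → M'`. -/
def changeRing (φ : R →ₐ[ℂ] R') (ψ : M →ₛₗ[(φ : R →+* R')] M') :
    HomAlg R V M →+* HomAlg R' V M' :=
  letI : Algebra R (HomAlg R' V M') :=
    ((algebraMap R' (HomAlg R' V M')).comp (φ : R →+* R')).toAlgebra
  (SymmetricAlgebra.lift (R := R) (A := HomAlg R' V M') (TensorProduct.lift
    (LinearMap.mk₂ R
      (fun (x : R ⊗[ℂ] V) (m : M) => SymmetricAlgebra.ι R' ((R' ⊗[ℂ] V) ⊗[R'] M')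
        ((LinearMap.rTensor V φ.toLinearMap x) ⊗ₜ[R'] ψ m))
      (fun x y m => by rw [map_add, TensorProduct.add_tmul, map_add])
      (fun r x m => by
        have h : LinearMap.rTensor V φ.toLinearMap (r • x)
            = φ r • LinearMap.rTensor V φ.toLinearMap x := by
          induction x with
          | zero => simp
          | add x y hx hy => rw [smul_add, map_add, hx, hy, map_add, smul_add]
          | tmul s v => simp [TensorProduct.smul_tmul']
        rw [h, ← TensorProduct.smul_tmul', map_smul, Algebra.smul_def, Algebra.smul_def]
        rfl)
      (fun x m n => by rw [map_add, TensorProduct.tmul_add, map_add])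
      (fun r x m => by
        rw [LinearMap.map_smulₛₗ, TensorProduct.tmul_smul, map_smul, Algebra.smul_def,
          Algebra.smul_def]
        rfl)))).toRingHom

lemma changeRing_algebraMap (φ : R →ₐ[ℂ] R') (ψ : M →ₛₗ[(φ : R →+* R')] M') (r : R) :
    changeRing (V := V) φ ψ (algebraMap R _ r) = algebraMap R' _ (φ r) := by
  let : Algebra R (HomAlg R' V M') :=
    ((algebraMap R' (HomAlg R' V M')).comp (φ : R →+* R')).toAlgebra
  exact AlgHom.commutes (A := HomAlg R V M) (B := HomAlg R' V M') _ r

lemma changeRing_ι (φ : R →ₐ[ℂ] R') (ψ : M →ₛₗ[(φ : R →+* R')] M') (r : R) (v : V) (m : M) :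
    changeRing φ ψ (SymmetricAlgebra.ι R _ ((r ⊗ₜ[ℂ] v) ⊗ₜ[R] m))
      = SymmetricAlgebra.ι R' _ ((φ r ⊗ₜ[ℂ] v) ⊗ₜ[R'] ψ m) := by
  let : Algebra R (HomAlg R' V M') :=
    ((algebraMap R' (HomAlg R' V M')).comp (φ : R →+* R')).toAlgebra
  refine (SymmetricAlgebra.lift_ι_apply (A := HomAlg R' V M') _ _).trans ?_
  simp

lemma changeRing_glAct (φ : R →ₐ[ℂ] R') (ψ : M →ₛₗ[(φ : R →+* R')] M') (g : V ≃ₗ[ℂ] V)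
    (p : HomAlg R V M) :
    changeRing φ ψ (glAct R M g p) = glAct R' M' g (changeRing φ ψ p) := by
  induction p using SymmetricAlgebra.induction with
  | algebraMap r => simp only [AlgHom.commutes, changeRing_algebraMap]
  | mul a b ha hb => simp only [map_mul, ha, hb]
  | add a b ha hb => simp only [map_add, ha, hb]
  | ι x =>
    induction x with
    | zero => simp
    | add x y hx hy => simp only [map_add, hx, hy]
    | tmul x m =>
      induction x with
      | zero => simp
      | add x y hx hy => simp only [TensorProduct.add_tmul, map_add, hx, hy]
      | tmul r v => simp [glAct, changeRing_ι]

/-- The ring homomorphism `Sym^*(V ⊗ M)^H → Sym^*(V ⊗ M')^H` induced by `R → R'` and a semilinear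
map `M → M'`. -/
def changeRingInvariants (H : Subgroup (V ≃ₗ[ℂ] V)) (φ : R →ₐ[ℂ] R')
    (ψ : M →ₛₗ[(φ : R →+* R')] M') : invariants R M H →+* invariants R' M' H :=
  ((changeRing φ ψ).comp (invariants R M H).val.toRingHom).codRestrict (invariants R' M' H)
    (fun p g hg => by
      change glAct R' M' g (changeRing φ ψ p.1) = changeRing φ ψ p.1
      rw [← changeRing_glAct, p.2 g hg])

end Affine

/-! ### Sheaves on a complex scheme -/

section Sheaves

variable {X : Scheme.{0}}

/-- Restriction of functions. -/
def resO {W W' : X.Opens} (h : W' ≤ W) : Γ(X, W) →+* Γ(X, W') :=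
  (X.presheaf.map (homOfLE h).op).hom

lemma resO_resO {W W' W'' : X.Opens} (h : W' ≤ W) (h' : W'' ≤ W') (f : Γ(X, W)) :
    resO h' (resO h f) = resO (h'.trans h) f := by
  simp only [resO, ← CommRingCat.comp_apply, ← Functor.map_comp]
  rfl

/-- Restriction of sections of an `O_X`-module. -/
def resM (A : X.Modules) {W W' : X.Opens} (h : W' ≤ W) : Γ(A, W) →ₛₗ[resO h] Γ(A, W') where
  toFun := A.presheaf.map (homOfLE h).op
  map_add' x y := map_add _ x y
  map_smul' r x := Scheme.Modules.map_smul A (homOfLE h) r x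

/-- `A` is free of finite rank on the open set `W`: there are finitely many sections over `W` whose
restrictions form a basis of `A(W')` over `O_X(W')` for all open subsets `W'` of `W`. -/
def IsFreeOn (A : X.Modules) (W : X.Opens) : Prop :=
  ∃ (n : ℕ) (s : Fin n → Γ(A, W)), ∀ (W' : X.Opens) (h : W' ≤ W),
    LinearIndependent Γ(X, W') (fun i => resM A h (s i)) ∧
      Submodule.span Γ(X, W') (Set.range fun i => resM A h (s i)) = ⊤

/-- The maximal open subset on which `A` is locally free of finite rank. -/
def locallyFreeLocus (A : X.Modules) : X.Opens := sSup {W | IsFreeOn A W}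

/-- The sections over `W` of the sheaf `(⋀^n A)^∨`, i.e. the alternating `O_X`-multilinear forms
`A^n → O_X` over `W`. -/
@[ext]
structure AltForm (A : X.Modules) (n : ℕ) (W : X.Opens) where
  form : ∀ W' : X.Opens, W' ≤ W → Γ(A, W') [⋀^Fin n]→ₗ[Γ(X, W')] Γ(X, W')
  res : ∀ (W' W'' : X.Opens) (h' : W' ≤ W) (h : W'' ≤ W') (v : Fin n → Γ(A, W')),
    form W'' (h.trans h') (fun i => resM A h (v i)) = resO h (form W' h' v)

namespace AltForm

variable {A : X.Modules} {n : ℕ} {W : X.Opens}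

/-- Addition of alternating forms. -/
def add (ω η : AltForm A n W) : AltForm A n W where
  form W' h := ω.form W' h + η.form W' h
  res W' W'' h' h v := by
    rw [AlternatingMap.add_apply, AlternatingMap.add_apply, map_add, ω.res, η.res]

/-- Multiplication of an alternating form by a function. -/
def smul (f : Γ(X, W)) (ω : AltForm A n W) : AltForm A n W where
  form W' h := resO h f • ω.form W' h
  res W' W'' h' h v := by
    rw [AlternatingMap.smul_apply, AlternatingMap.smul_apply, smul_eq_mul, smul_eq_mul, map_mul,
      ω.res, resO_resO]

/-- Restriction of an alternating form. -/
def restrict (ω : AltForm A n W) {W₁ : X.Opens} (h₁ : W₁ ≤ W) : AltForm A n W₁ where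
  form W' h := ω.form W' (h.trans h₁)
  res W' W'' h' h v := ω.res W' W'' (h'.trans h₁) h v

end AltForm

/-- The sections over `W` of the sheaf `(⋀^n A)^∨∨`, i.e. the `O_X`-linear maps
`(⋀^n A)^∨ → O_X` over `W`. If `A` is torsion free of rank `n`, this sheaf is `det A`. -/
structure DetSection (A : X.Modules) (n : ℕ) (W : X.Opens) where
  eval : ∀ W' : X.Opens, W' ≤ W → AltForm A n W' → Γ(X, W')
  add : ∀ (W' : X.Opens) (h : W' ≤ W) (ω η : AltForm A n W'),
    eval W' h (ω.add η) = eval W' h ω + eval W' h η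
  smul : ∀ (W' : X.Opens) (h : W' ≤ W) (f : Γ(X, W')) (ω : AltForm A n W'),
    eval W' h (ω.smul f) = f * eval W' h ω
  res : ∀ (W' W'' : X.Opens) (h' : W' ≤ W) (h : W'' ≤ W') (ω : AltForm A n W'),
    eval W'' (h.trans h') (ω.restrict h) = resO h (eval W' h' ω)

/-- `det A ≅ O_X` for `det A = (⋀^n A)^∨∨`: there is a global section `s` of `det A` such that
`O_X → det A`, `f ↦ f s`, is bijective on the sections over every open set. -/
def HasTrivialDet (A : X.Modules) (n : ℕ) : Prop :=
  ∃ s : DetSection A n ⊤, ∀ (W : X.Opens) (t : DetSection A n W), ∃! f : Γ(X, W),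
    ∀ (W' : X.Opens) (h : W' ≤ W) (ω : AltForm A n W'),
      t.eval W' h ω = resO h f * s.eval W' le_top ω

/-- Coherent torsion free sheaves of rank `n` on an integral noetherian scheme. -/
structure IsTorsionFreeOfRank (A : X.Modules) (n : ℕ) : Prop where
  quasicoherent : A.IsQuasicoherent
  finite : ∀ W : X.Opens, IsAffineOpen W → Module.Finite Γ(X, W) Γ(A, W)
  torsionFree : ∀ W : X.Opens, IsAffineOpen W → Module.IsTorsionFree Γ(X, W) Γ(A, W)
  rank : ∀ W : X.Opens, IsAffineOpen W → (W : Set X).Nonempty →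
    Module.rank Γ(X, W) Γ(A, W) = n

variable [X.Over (Spec (CommRingCat.of ℂ))]

variable (X) in
/-- The structure map `ℂ → O_X(W)` of a complex scheme. -/
def structureMap (W : X.Opens) : ℂ →+* Γ(X, W) :=
  (resO le_top).comp (((X ↘ Spec (CommRingCat.of ℂ)).appTop.hom).comp
    (Scheme.ΓSpecIso (CommRingCat.of ℂ)).inv.hom)

instance algebraSections (W : X.Opens) : Algebra ℂ Γ(X, W) := (structureMap X W).toAlgebra

/-- Restriction of functions on a complex scheme, as a homomorphism of `ℂ`-algebras. -/
def resAlg {W W' : X.Opens} (h : W' ≤ W) : Γ(X, W) →ₐ[ℂ] Γ(X, W') where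
  __ := resO h
  commutes' _ := resO_resO le_top h _

variable {V : Type} [AddCommGroup V] [Module ℂ V]

/-- The restriction maps of the sheaf of algebras `Sym^*(V ⊗ A)^H`. -/
def resInvariants (H : Subgroup (V ≃ₗ[ℂ] V)) (A : X.Modules) {W W' : X.Opens} (h : W' ≤ W) :
    invariants Γ(X, W) Γ(A, W) H →+* invariants Γ(X, W') Γ(A, W') H :=
  changeRingInvariants H (resAlg h) (resM A h)

variable (X) in
/-- Singular principal `H`-bundles `(A, τ)` on `X`, for a subgroup `H` of `GL(V)`: a coherent torsion
free sheaf `A` of rank `dim V` with trivial determinant and a homomorphism of `O_X`-algebras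
`τ : Sym^*(V ⊗ A)^H → O_X` for which the section of `Spec (Sym^*(V ⊗ A)^H)` induced by `τ` is not the
zero section. As `A` is quasi-coherent, the sections of `Sym^*(V ⊗ A)^H` over an affine open set
`W` are the invariants in `Sym^*(V ⊗ A(W))`, and `τ` is given by its values on affine open sets. -/
structure SingularPrincipalBundle (H : Subgroup (V ≃ₗ[ℂ] V)) where
  A : X.Modules
  torsionFree : IsTorsionFreeOfRank A (Module.finrank ℂ V)
  trivialDet : HasTrivialDet A (Module.finrank ℂ V)
  τ : ∀ W : X.Opens, IsAffineOpen W → (invariants Γ(X, W) Γ(A, W) H →ₐ[Γ(X, W)] Γ(X, W))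
  τ_res : ∀ (W W' : X.Opens) (hW : IsAffineOpen W) (hW' : IsAffineOpen W') (h : W' ≤ W)
    (p : invariants Γ(X, W) Γ(A, W) H),
    τ W' hW' (resInvariants H A h p) = resO h (τ W hW p)
  nontrivial : ∃ (W : X.Opens) (hW : IsAffineOpen W) (p : invariants Γ(X, W) Γ(A, W) H),
    τ W hW p ≠ SymmetricAlgebra.algebraMapInv (p : HomAlg Γ(X, W) V Γ(A, W))

namespace SingularPrincipalBundle

variable {H : Subgroup (V ≃ₗ[ℂ] V)} (B : SingularPrincipalBundle X H)

/-- The maximal open subset `U` of `X` on which `A` is locally free. -/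
def U : X.Opens := locallyFreeLocus B.A

/-- The value at `x ∈ W`, for `W` affine open, of the section `σ : W → Spec (Sym^*(V ⊗ A(W))^H)`
defined by `τ`. For `W ⊆ U` the target is the part of `Hom(V ⊗ O_U, A^∨) // H` over `W`. -/
def σ {W : X.Opens} (hW : IsAffineOpen W) (x : W) :
    PrimeSpectrum (invariants Γ(X, W) Γ(B.A, W) H) :=
  PrimeSpectrum.comap (B.τ W hW).toRingHom (hW.primeIdealOf x)

/-- `σ` is entirely contained in `Isom(V ⊗ O_U, A^∨)/H`; one says that `(A, τ)` is honest. -/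
def IsHonest : Prop :=
  ∀ (W : X.Opens) (hW : IsAffineOpen W), W ≤ B.U → ∀ x : W,
    B.σ hW x ∈ isomQuotient Γ(X, W) Γ(B.A, W) H

/-- `σ` is entirely contained in the complement of `Isom(V ⊗ O_U, A^∨)/H`. -/
def AvoidsIsom : Prop :=
  ∀ (W : X.Opens) (hW : IsAffineOpen W), W ≤ B.U → ∀ x : W,
    B.σ hW x ∈ (isomQuotient Γ(X, W) Γ(B.A, W) H)ᶜ

end SingularPrincipalBundle

end Sheaves

end SingularBundle

end

noncomputable section

namespace SingularBundle

/-! Because the weights of `ℂ^*` on `W` are positive, `0` lies outside the closed orbit `SL(V) w₀`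
but in the closure of `ℂ^* w₀`, so only finitely many homotheties move `w₀` inside this orbit.
Hence `det` takes finitely many values on `G̃`, some power `det ^ N` is trivial on `G̃`, and `G` has
finite index in `G̃`.

The products of `N` determinants of the universal homomorphism `V ⊗ O → A^∨` are therefore
`G̃`-invariant. As `det A` is trivial, `(⋀^n A)^∨` is freely generated by a form `vol`, and over the
locus where `A` is free `τ` maps such a product to `f * ∏ᵢ vol (mᵢ)` for a regular function `f`.
Clearing the factors `vol (mᵢ)` one at a time (if `a * vol` is regular as a form, then `a` is
regular as a function) shows that `f` extends to all of `X`.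

The quotient map `Hom(V ⊗ O, A^∨) → Hom(V ⊗ O, A^∨) // G̃` is surjective on points, since ideals of
the ring of invariants are contracted from their extensions, and a homomorphism is invertible where
its determinant does not vanish. So `σ(x)` lies in `Isom(V ⊗ O, A^∨)/G̃` if and only if `f(x) ≠ 0`.
Finally, the nonzero global functions on `X` are units, `X` being proper and integral.
-/

section RegularMaps

variable {Γ k : Type*} [Field k] {𝒜 : Subalgebra k (Γ → k)}
variable {E E' : Type*} [AddCommGroup E] [Module k E] [AddCommGroup E'] [Module k E']

variable (𝒜 E) in
/-- The maps `Γ → E` of the form `g ↦ ∑ pᵢ(g) eᵢ` with `pᵢ ∈ 𝒜` and `eᵢ ∈ E`: if `𝒜` is the algebra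
of regular functions on `Γ`, these are the regular maps to the vector space `E`. -/
def regularMaps : Submodule 𝒜 (Γ → E) :=
  Submodule.span 𝒜 (Set.range (Function.const Γ))

lemma const_mem_regularMaps (e : E) : Function.const Γ e ∈ regularMaps 𝒜 E :=
  Submodule.subset_span ⟨e, rfl⟩

lemma comp_mem_regularMaps (L : E →ₗ[k] E') {f : Γ → E} (hf : f ∈ regularMaps 𝒜 E) :
    (fun g => L (f g)) ∈ regularMaps 𝒜 E' := by
  induction hf using Submodule.span_induction with
  | mem f hf =>
    obtain ⟨e, rfl⟩ := hf
    exact const_mem_regularMaps (L e)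
  | zero =>
    convert zero_mem (regularMaps 𝒜 E') using 1
    exact funext fun _ => map_zero L
  | add f f' _ _ hf hf' =>
    convert add_mem hf hf' using 1
    ext g
    exact map_add L (f g) (f' g)
  | smul p f _ hf =>
    convert Submodule.smul_mem _ p hf using 1
    ext g
    exact map_smul L (p.1 g) (f g)

lemma dual_comp_mem_of_mem_regularMaps (ξ : Module.Dual k E) {f : Γ → E}
    (hf : f ∈ regularMaps 𝒜 E) : (fun g => ξ (f g)) ∈ 𝒜 := by
  induction hf using Submodule.span_induction with
  | mem f hf =>
    obtain ⟨e, rfl⟩ := hf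
    exact 𝒜.algebraMap_mem (ξ e)
  | zero =>
    convert zero_mem 𝒜 using 1
    exact funext fun _ => map_zero ξ
  | add f f' _ _ hf hf' =>
    convert add_mem hf hf' using 1
    ext g
    exact map_add ξ (f g) (f' g)
  | smul p f _ hf =>
    convert mul_mem p.2 hf using 1
    ext g
    exact map_smul ξ (p.1 g) (f g)

lemma finiteDimensional_span_range_of_mem_regularMaps {f : Γ → E} (hf : f ∈ regularMaps 𝒜 E) :
    FiniteDimensional k (Submodule.span k (Set.range f)) := by
  suffices ∃ F : Submodule k E, FiniteDimensional k F ∧ ∀ g, f g ∈ F by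
    obtain ⟨F, _, hF⟩ := this
    exact Submodule.finiteDimensional_of_le (Submodule.span_le.2 (Set.range_subset_iff.2 hF))
  induction hf using Submodule.span_induction with
  | mem f hf =>
    obtain ⟨e, rfl⟩ := hf
    exact ⟨Submodule.span k {e}, inferInstance, fun _ => Submodule.mem_span_singleton_self e⟩
  | zero => exact ⟨⊥, inferInstance, fun _ => zero_mem _⟩
  | add f f' _ _ hf hf' =>
    obtain ⟨F, _, hF⟩ := hf
    obtain ⟨F', _, hF'⟩ := hf'
    exact ⟨F ⊔ F', inferInstance, fun g => Submodule.add_mem_sup (hF g) (hF' g)⟩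
  | smul p f _ hf =>
    obtain ⟨F, _, hF⟩ := hf
    exact ⟨F, ‹_›, fun g => F.smul_mem (p.1 g) (hF g)⟩

lemma mul_mem_regularMaps {S : Type*} [CommRing S] [Algebra k S] {f f' : Γ → S}
    (hf : f ∈ regularMaps 𝒜 S) (hf' : f' ∈ regularMaps 𝒜 S) : f * f' ∈ regularMaps 𝒜 S := by
  induction hf using Submodule.span_induction with
  | mem f hf =>
    obtain ⟨s, rfl⟩ := hf
    exact comp_mem_regularMaps (LinearMap.mulLeft k s) hf'
  | zero => rw [zero_mul]; exact zero_mem _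
  | add f₁ f₂ _ _ h₁ h₂ => rw [add_mul]; exact add_mem h₁ h₂
  | smul p f _ hf =>
    convert Submodule.smul_mem _ p hf using 1
    ext g
    exact smul_mul_assoc (p.1 g) (f g) (f' g)

end RegularMaps

section InvariantLifts

variable {k Γ E E' : Type*} [Field k] [Group Γ] [AddCommGroup E] [Module k E]
  [AddCommGroup E'] [Module k E']

-- The component of `x` in an invariant complement of `ker L` is invariant.
lemma exists_mem_invariants_of_isCompl_ker (π : Representation k Γ E) (L : E →ₗ[k] E')
    (hL : ∀ g x, L (π g x) = L x) {F : Submodule k E} (hF : ∀ g, F ≤ F.comap (π g))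
    (hc : IsCompl (LinearMap.ker L) F) (x : E) : ∃ y ∈ π.invariants, L y = L x := by
  obtain ⟨z, hz, y, hy, rfl⟩ : ∃ z ∈ LinearMap.ker L, ∃ y ∈ F, z + y = x :=
    Submodule.mem_sup.1 (hc.sup_eq_top ▸ Submodule.mem_top)
  refine ⟨y, fun g => sub_eq_zero.1 ?_, by rw [map_add, LinearMap.mem_ker.1 hz, zero_add]⟩
  rw [← Submodule.mem_bot k, ← hc.inf_eq_bot]
  exact ⟨by rw [SetLike.mem_coe, LinearMap.mem_ker, map_sub, hL, sub_self], sub_mem (hF g hy) hy⟩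

lemma exists_mem_invariants_of_finiteIndex [CharZero k] (π : Representation k Γ E)
    (G : Subgroup Γ) [G.FiniteIndex] (L : E →ₗ[k] E') {x : E} (hx : ∀ g ∈ G, π g x = x)
    (hL : ∀ g, L (π g x) = L x) : ∃ y ∈ π.invariants, L y = L x := by
  have := Fintype.ofFinite (Γ ⧸ G)
  let orbitMap : Γ ⧸ G → E := Quotient.lift (fun g => π g x) fun a b hab => by
    conv_lhs => rw [← hx _ (QuotientGroup.leftRel_apply.1 hab), ← Module.End.mul_apply, ← map_mul,
      mul_inv_cancel_left]
  have hmk (g : Γ) : orbitMap (g : Γ ⧸ G) = π g x := rfl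
  refine ⟨(Fintype.card (Γ ⧸ G) : k)⁻¹ • ∑ q, orbitMap q, fun g => ?_, ?_⟩
  · rw [map_smul, map_sum]
    refine congrArg _ (Fintype.sum_equiv (MulAction.toPerm g) _ _ fun q => ?_)
    induction q using QuotientGroup.induction_on with
    | H a =>
      rw [MulAction.toPerm_apply, MulAction.Quotient.smul_coe, hmk, hmk, smul_eq_mul, map_mul,
        Module.End.mul_apply]
  · have hconst (q : Γ ⧸ G) : L (orbitMap q) = L x := by
      induction q using QuotientGroup.induction_on with
      | H a => exact hL a
    rw [map_smul, map_sum, Fintype.sum_congr _ _ hconst, Finset.sum_const, Finset.card_univ,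
      ← Nat.cast_smul_eq_nsmul k, inv_smul_smul₀ (Nat.cast_ne_zero.2 Fintype.card_ne_zero)]

end InvariantLifts

section Reductive

variable {V : Type} [AddCommGroup V] [Module ℂ V]

/-- A possibly infinite dimensional representation of `GL(V)` is locally rational if all of its
orbit maps are regular. -/
def IsLocallyRational {E : Type*} [AddCommGroup E] [Module ℂ E]
    (ρ : Representation ℂ (V ≃ₗ[ℂ] V) E) : Prop :=
  ∀ e, (fun g => ρ g e) ∈ regularMaps (regularFunctions V) E

variable {G : Subgroup (V ≃ₗ[ℂ] V)} {E : Type} {E' : Type*} [AddCommGroup E] [Module ℂ E]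
  [AddCommGroup E'] [Module ℂ E'] {ρ : Representation ℂ (V ≃ₗ[ℂ] V) E}

lemma IsReductive.exists_invariant (hG : IsReductive G) (hρ : IsLocallyRational ρ)
    (L : E →ₗ[ℂ] E') {e₀ : E} (h : ∀ g ∈ G, L (ρ g e₀) = L e₀) :
    ∃ e, (∀ g ∈ G, ρ g e = e) ∧ L e = L e₀ := by
  set F : Submodule ℂ E := Submodule.span ℂ (Set.range fun g : G => ρ g e₀)
  have hF (g : G) : F ≤ F.comap (ρ.comp G.subtype g) := by
    rintro _ hx
    refine Submodule.span_le.2 ?_ hx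
    rintro _ ⟨g', rfl⟩
    exact Submodule.subset_span ⟨g * g', by simp⟩
  have hL (g : G) : Set.EqOn (L ∘ₗ ρ g) L F := by
    refine LinearMap.eqOn_span (f := L ∘ₗ ρ g) (g := L) ?_
    rintro _ ⟨g', rfl⟩
    rw [LinearMap.comp_apply, ← Module.End.mul_apply, ← map_mul, h _ (mul_mem g.2 g'.2),
      h _ g'.2]
  have : FiniteDimensional ℂ F := by
    have := finiteDimensional_span_range_of_mem_regularMaps (hρ e₀)
    exact Submodule.finiteDimensional_of_le
      (Submodule.span_mono (Set.range_comp_subset_range ((↑) : G → _) fun g => ρ g e₀))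
  set π : Representation ℂ G F := Representation.subrepresentation (ρ.comp G.subtype) F hF
  have hrat : IsRationalRepOf G π := by
    intro ξ e
    obtain ⟨η, rfl⟩ := LinearMap.exists_extend ξ
    exact ⟨_, dual_comp_mem_of_mem_regularMaps η (hρ e), fun g => rfl⟩
  have hLπ (g : G) (x : F) : (L ∘ₗ F.subtype) (π g x) = (L ∘ₗ F.subtype) x := hL g x.2
  obtain ⟨K, hK, hcompl⟩ := hG.2 F π hrat (LinearMap.ker (L ∘ₗ F.subtype)) fun g x hx => by
    rw [Submodule.mem_comap, LinearMap.mem_ker, hLπ, LinearMap.mem_ker.1 hx]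
  obtain ⟨y, hy, hLy⟩ := exists_mem_invariants_of_isCompl_ker π _ hLπ hK hcompl
    ⟨e₀, Submodule.subset_span ⟨1, by simp⟩⟩
  exact ⟨y, fun g hg => congrArg Subtype.val (hy ⟨g, hg⟩), hLy⟩

-- Apply `IsReductive.exists_invariant` to `e ↦ (h ↦ L (ρ h e))`, so that the `G`-invariant lift of
-- `e₀` has an orbit under `H` on which `L` is constant.
lemma IsReductive.exists_invariant_of_finiteIndex (hG : IsReductive G)
    {H : Subgroup (V ≃ₗ[ℂ] V)} (hGH : G ≤ H) [(G.subgroupOf H).FiniteIndex]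
    (hρ : IsLocallyRational ρ) (L : E →ₗ[ℂ] E') {e₀ : E} (h : ∀ g ∈ H, L (ρ g e₀) = L e₀) :
    ∃ e, (∀ g ∈ H, ρ g e = e) ∧ L e = L e₀ := by
  obtain ⟨e, he, hLe⟩ := hG.exists_invariant hρ (LinearMap.pi fun g : H => L ∘ₗ ρ g) (e₀ := e₀)
    fun g hg => by
      ext g'
      change L (ρ g' (ρ g e₀)) = L (ρ g' e₀)
      rw [← Module.End.mul_apply, ← map_mul, h _ (mul_mem g'.2 (hGH hg)), h _ g'.2]
  have hLρ (g : H) : L (ρ g e) = L e₀ := (congrFun hLe g).trans (h g g.2)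
  have hLe₀ : L e = L e₀ := by simpa using hLρ 1
  obtain ⟨y, hy, hLy⟩ := exists_mem_invariants_of_finiteIndex (ρ.comp H.subtype) (G.subgroupOf H) L
    (fun g hg => he g (Subgroup.mem_subgroupOf.1 hg)) fun g => (hLρ g).trans hLe₀.symm
  exact ⟨y, fun g hg => hy ⟨g, hg⟩, hLy.trans hLe₀⟩

end Reductive

section Stabilizer

variable {V : Type} [AddCommGroup V] [Module ℂ V]
variable {W : Type} [AddCommGroup W] [Module ℂ W]
variable {G : Subgroup (V ≃ₗ[ℂ] V)} {κ : Representation ℂ (V ≃ₗ[ℂ] V) W} {w₀ : W}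

lemma IsOrbitEmbedding.exists_polynomial_dual (hκ : IsOrbitEmbedding G κ w₀)
    (ξ : Module.Dual ℂ W) :
    ∃ Q : Polynomial ℂ, Q.eval 0 = 0 ∧
      ∀ z : ℂˣ, Q.eval (z : ℂ) = ξ (κ (LinearEquiv.smulOfUnit z) w₀) := by
  have hw₀ := hκ.weights_pos ▸ Submodule.mem_top (x := w₀)
  clear hκ
  induction hw₀ using Submodule.span_induction with
  | mem w hw =>
    obtain ⟨n, hn, hw⟩ := hw
    refine ⟨Polynomial.C (ξ w) * Polynomial.X ^ n, by simp [hn.ne'], fun z => ?_⟩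
    rw [hw, map_smul, Polynomial.eval_C_mul, Polynomial.eval_pow, Polynomial.eval_X, smul_eq_mul,
      mul_comm]
  | zero => exact ⟨0, by simp, by simp⟩
  | add x y _ _ hx hy =>
    obtain ⟨Q, hQ0, hQ⟩ := hx
    obtain ⟨Q', hQ0', hQ'⟩ := hy
    exact ⟨Q + Q', by simp [hQ0, hQ0'], fun z => by simp [hQ, hQ']⟩
  | smul a x _ hx =>
    obtain ⟨Q, hQ0, hQ⟩ := hx
    exact ⟨Polynomial.C a * Q, by simp [hQ0], fun z => by simp [hQ]⟩

-- The orbit of `w₀` under the homotheties extends to `z = 0` because all weights are positive.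
lemma IsOrbitEmbedding.exists_polynomial (hκ : IsOrbitEmbedding G κ w₀) {p : W → ℂ}
    (hp : p ∈ polynomialFunctions W) :
    ∃ Q : Polynomial ℂ, Q.eval 0 = p 0 ∧
      ∀ z : ℂˣ, Q.eval (z : ℂ) = p (κ (LinearEquiv.smulOfUnit z) w₀) := by
  induction hp using Algebra.adjoin_induction with
  | mem p hp =>
    obtain ⟨ξ, rfl⟩ := hp
    simpa only [map_zero] using hκ.exists_polynomial_dual ξ
  | algebraMap r => exact ⟨Polynomial.C r, by simp, by simp⟩
  | add x y _ _ hx hy =>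
    obtain ⟨Q, hQ0, hQ⟩ := hx
    obtain ⟨Q', hQ0', hQ'⟩ := hy
    exact ⟨Q + Q', by simp [hQ0, hQ0'], fun z => by simp [hQ, hQ']⟩
  | mul x y _ _ hx hy =>
    obtain ⟨Q, hQ0, hQ⟩ := hx
    obtain ⟨Q', hQ0', hQ'⟩ := hy
    exact ⟨Q * Q', by simp [hQ0, hQ0'], fun z => by simp [hQ, hQ']⟩

lemma IsOrbitEmbedding.finite_homotheties (hκ : IsOrbitEmbedding G κ w₀) :
    {z : ℂˣ | ∃ g : V ≃ₗ[ℂ] V, LinearEquiv.det g = 1 ∧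
      κ (LinearEquiv.smulOfUnit z) w₀ = κ g w₀}.Finite := by
  obtain ⟨P, hP, horbit⟩ := hκ.closed
  have mem_zeros_iff (w : W) : (∀ p ∈ P, p w = 0) ↔
      ∃ g : V ≃ₗ[ℂ] V, LinearMap.det (g : V →ₗ[ℂ] V) = 1 ∧ w = κ g w₀ :=
    (Set.ext_iff.1 horbit w).symm
  obtain ⟨p, hpP, hp0⟩ : ∃ p ∈ P, p 0 ≠ 0 := by
    by_contra! h
    obtain ⟨g, -, hg⟩ := (mem_zeros_iff 0).1 h
    exact hκ.ne_zero ((κ.apply_bijective g).1 (hg.symm.trans (map_zero (κ g)).symm))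
  obtain ⟨Q, hQ0, hQ⟩ := hκ.exists_polynomial (hP hpP)
  have hQne : Q ≠ 0 := by
    rintro rfl
    exact hp0 (by simpa using hQ0.symm)
  refine Set.Finite.of_finite_image ((Q.rootSet_finite ℂ).subset ?_) Units.val_injective.injOn
  rintro _ ⟨z, ⟨g, hg, hz⟩, rfl⟩
  have hroot : p (κ (LinearEquiv.smulOfUnit z) w₀) = 0 :=
    (mem_zeros_iff _).2 ⟨g, by simpa using congrArg Units.val hg, hz⟩ p hpP
  simpa [Polynomial.mem_rootSet_of_ne hQne] using (hQ z).trans hroot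

lemma det_smulOfUnit (z : ℂˣ) :
    LinearEquiv.det (LinearEquiv.smulOfUnit z : V ≃ₗ[ℂ] V) = z ^ Module.finrank ℂ V := by
  ext
  have : ((LinearEquiv.smulOfUnit z : V ≃ₗ[ℂ] V) : V →ₗ[ℂ] V) = (z : ℂ) • LinearMap.id := rfl
  rw [LinearEquiv.coe_det, this, LinearMap.det_smul, LinearMap.det_id, mul_one,
    Units.val_pow_eq_pow_val]

lemma exists_det_smulOfUnit_eq (g : V ≃ₗ[ℂ] V) :
    ∃ z : ℂˣ, LinearEquiv.det (LinearEquiv.smulOfUnit z : V ≃ₗ[ℂ] V) = LinearEquiv.det g := by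
  obtain h0 | hpos := (Module.finrank ℂ V).eq_zero_or_pos
  · refine ⟨1, Units.ext ?_⟩
    rw [LinearEquiv.coe_det, LinearEquiv.coe_det, LinearMap.det_eq_one_of_finrank_eq_zero h0,
      LinearMap.det_eq_one_of_finrank_eq_zero h0]
  · obtain ⟨z, hz⟩ := IsAlgClosed.exists_pow_nat_eq (LinearEquiv.det g : ℂ) hpos
    have hz0 : z ≠ 0 := by
      rintro rfl
      exact (LinearEquiv.det g).ne_zero (hz.symm.trans (zero_pow hpos.ne'))
    exact ⟨Units.mk0 z hz0, Units.ext (by rw [det_smulOfUnit, ← hz]; rfl)⟩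

-- If `det g = det z` for a homothety `z`, then `z g⁻¹ ∈ SL(V)` maps `w₀` to `z w₀`.
lemma IsOrbitEmbedding.finite_map_det (hκ : IsOrbitEmbedding G κ w₀) :
    Finite ((stabilizerGL κ w₀).map LinearEquiv.det) := by
  refine (hκ.finite_homotheties.image (· ^ Module.finrank ℂ V)).subset ?_ |>.to_subtype
  rintro _ ⟨g, hg, rfl⟩
  obtain ⟨z, hz⟩ := exists_det_smulOfUnit_eq g
  refine ⟨z, ⟨LinearEquiv.smulOfUnit z * g⁻¹, by rw [map_mul, map_inv, hz, mul_inv_cancel], ?_⟩,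
    (det_smulOfUnit z).symm.trans hz⟩
  rw [map_mul, Module.End.mul_apply, show κ g⁻¹ w₀ = w₀ from inv_mem hg]

lemma IsOrbitEmbedding.exists_det_pow_eq_one (hκ : IsOrbitEmbedding G κ w₀) :
    ∃ N ≠ 0, ∀ g ∈ stabilizerGL κ w₀, LinearEquiv.det g ^ N = 1 := by
  have := hκ.finite_map_det
  refine ⟨Nat.card ((stabilizerGL κ w₀).map LinearEquiv.det), Nat.card_pos.ne', fun g hg => ?_⟩
  exact congrArg Subtype.val
    (pow_card_eq_one' (x := ⟨_, Subgroup.mem_map_of_mem LinearEquiv.det hg⟩))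

lemma IsOrbitEmbedding.le_stabilizerGL (hκ : IsOrbitEmbedding G κ w₀) : G ≤ stabilizerGL κ w₀ :=
  fun g hg => ((hκ.stabilizer g).1 hg).2

lemma IsOrbitEmbedding.finiteIndex (hκ : IsOrbitEmbedding G κ w₀) :
    (G.subgroupOf (stabilizerGL κ w₀)).FiniteIndex := by
  have hker : G.subgroupOf (stabilizerGL κ w₀)
      = (LinearEquiv.det.comp (stabilizerGL κ w₀).subtype).ker := by
    ext g
    rw [Subgroup.mem_subgroupOf, hκ.stabilizer, MonoidHom.mem_ker, ← LinearEquiv.coe_det,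
      Units.val_eq_one]
    exact and_iff_left g.2
  have : Finite (LinearEquiv.det.comp (stabilizerGL κ w₀).subtype).range := by
    rw [MonoidHom.range_comp, Subgroup.range_subtype]
    exact hκ.finite_map_det
  rw [hker]
  exact Subgroup.finiteIndex_ker _

end Stabilizer

section HomAlg

variable {R : Type} [CommRing R] [Algebra ℂ R]
variable {V : Type} [AddCommGroup V] [Module ℂ V]
variable {M : Type} [AddCommGroup M] [Module R M]

lemma ι_tmul_eq_smul_gen (r : R) (v : V) (m : M) :
    SymmetricAlgebra.ι R ((R ⊗[ℂ] V) ⊗[R] M) ((r ⊗ₜ[ℂ] v) ⊗ₜ[R] m) = r • gen v m := by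
  rw [gen, ← map_smul, TensorProduct.smul_tmul', TensorProduct.smul_tmul', smul_eq_mul, mul_one]

@[elab_as_elim]
lemma HomAlg.induction {motive : HomAlg R V M → Prop}
    (algebraMap : ∀ r, motive (algebraMap R _ r)) (gen : ∀ v m, motive (gen v m))
    (mul : ∀ a b, motive a → motive b → motive (a * b))
    (add : ∀ a b, motive a → motive b → motive (a + b)) (p : HomAlg R V M) : motive p := by
  induction p using SymmetricAlgebra.induction with
  | algebraMap r => exact algebraMap r
  | mul a b ha hb => exact mul a b ha hb
  | add a b ha hb => exact add a b ha hb
  | ι x =>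
    induction x with
    | zero => simpa using algebraMap 0
    | add x y hx hy => rw [map_add]; exact add _ _ hx hy
    | tmul x m =>
      induction x with
      | zero => simpa using algebraMap 0
      | add x y hx hy => rw [TensorProduct.add_tmul, map_add]; exact add _ _ hx hy
      | tmul r v =>
        rw [ι_tmul_eq_smul_gen, Algebra.smul_def]
        exact mul _ _ (algebraMap r) (gen v m)

lemma HomAlg.algHom_ext {S : Type*} [CommSemiring S] [Algebra R S] {f g : HomAlg R V M →ₐ[R] S}
    (h : ∀ v m, f (gen v m) = g (gen v m)) : f = g := by
  refine AlgHom.ext fun p => ?_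
  induction p using HomAlg.induction with
  | algebraMap r => rw [f.commutes, g.commutes]
  | gen v m => exact h v m
  | mul a b ha hb => rw [map_mul, map_mul, ha, hb]
  | add a b ha hb => rw [map_add, map_add, ha, hb]

variable (R V M) in
/-- The representation of `GL(V)` on `Sym^*(V ⊗ M)` given by `glAct`. -/
def glRep : Representation ℂ (V ≃ₗ[ℂ] V) (HomAlg R V M) where
  toFun g := (glAct R M g).toLinearMap.restrictScalars ℂ
  map_one' := by
    have : glAct R M (1 : V ≃ₗ[ℂ] V) = AlgHom.id R _ :=
      HomAlg.algHom_ext fun v m => by rw [glAct_gen]; rfl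
    rw [this]
    rfl
  map_mul' g g' := by
    have : glAct R M (g * g') = (glAct R M g).comp (glAct R M g') :=
      HomAlg.algHom_ext fun v m => by
        rw [AlgHom.comp_apply, glAct_gen, glAct_gen, glAct_gen, LinearEquiv.mul_apply]
    rw [this]
    rfl

lemma glRep_apply (g : V ≃ₗ[ℂ] V) (p : HomAlg R V M) : glRep R V M g p = glAct R M g p := rfl

/-- The generators `v ⊗ m` of `Sym^*(V ⊗ M)`, as a linear function of `v`. -/
def genLeft (m : M) : V →ₗ[ℂ] HomAlg R V M :=
  (SymmetricAlgebra.ι R _ ∘ₗ (TensorProduct.mk R (R ⊗[ℂ] V) M).flip m).restrictScalars ℂ ∘ₗ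
    TensorProduct.mk ℂ R V 1

/-- The generators `v ⊗ m` of `Sym^*(V ⊗ M)`, as a linear function of `m`. -/
def genRight (v : V) : M →ₗ[R] HomAlg R V M :=
  SymmetricAlgebra.ι R _ ∘ₗ TensorProduct.mk R (R ⊗[ℂ] V) M (1 ⊗ₜ v)

lemma genLeft_apply (m : M) (v : V) : genLeft (R := R) m v = gen v m := rfl

lemma evaluation_mem_regularMaps [FiniteDimensional ℂ V] (v : V) :
    (fun g : V ≃ₗ[ℂ] V => g v) ∈ regularMaps (regularFunctions V) V := by
  let b := Module.finBasis ℂ V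
  have hcoord (i) : (fun g : V ≃ₗ[ℂ] V => b.coord i (g v)) ∈ regularFunctions V :=
    Algebra.subset_adjoin (Or.inl ⟨b.coord i, v, rfl⟩)
  convert sum_mem fun i (_ : i ∈ Finset.univ) => Submodule.smul_mem _
    (⟨_, hcoord i⟩ : regularFunctions V) (const_mem_regularMaps (b i)) using 1
  ext1 g
  rw [Finset.sum_apply]
  exact (b.sum_repr (g v)).symm

lemma isLocallyRational_glRep [FiniteDimensional ℂ V] : IsLocallyRational (glRep R V M) := by
  intro p
  simp only [glRep_apply]
  induction p using HomAlg.induction with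
  | algebraMap r =>
    simp only [AlgHom.commutes]
    exact const_mem_regularMaps _
  | gen v m =>
    simp only [glAct_gen]
    exact comp_mem_regularMaps (genLeft m : V →ₗ[ℂ] HomAlg R V M) (evaluation_mem_regularMaps v)
  | mul a b ha hb =>
    simp only [map_mul]
    exact mul_mem_regularMaps ha hb
  | add a b ha hb =>
    simp only [map_add]
    exact add_mem ha hb

end HomAlg

section LyingOver

/-- The diagonal action on the power `E^ι` of a representation `E`. -/
def powRep {k Γ E : Type*} [CommSemiring k] [Monoid Γ] [AddCommMonoid E] [Module k E]
    (ρ : Representation k Γ E) (ι : Type*) : Representation k Γ (ι → E) where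
  toFun g := (ρ g).compLeft ι
  map_one' := by ext; simp
  map_mul' g g' := by ext; simp

lemma powRep_apply {k Γ E : Type*} [CommSemiring k] [Monoid Γ] [AddCommMonoid E] [Module k E]
    (ρ : Representation k Γ E) {ι : Type*} (g : Γ) (e : ι → E) (i : ι) :
    powRep ρ ι g e i = ρ g (e i) := rfl

variable {V : Type} [AddCommGroup V] [Module ℂ V]

lemma IsLocallyRational.powRep {E ι : Type*} [AddCommGroup E] [Module ℂ E] [Finite ι]
    {ρ : Representation ℂ (V ≃ₗ[ℂ] V) E} (hρ : IsLocallyRational ρ) :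
    IsLocallyRational (powRep ρ ι) := by
  classical
  intro e
  have := Fintype.ofFinite ι
  have hsum : (fun g => SingularBundle.powRep ρ ι g e)
      = ∑ i, fun g => LinearMap.single ℂ (fun _ => E) i (ρ g (e i)) := by
    ext g j
    simp [powRep_apply, Finset.sum_apply, Pi.single_apply]
  rw [hsum]
  exact sum_mem fun i _ => comp_mem_regularMaps _ (hρ (e i))

variable {R : Type} [CommRing R] [Algebra ℂ R]
variable {M : Type} [AddCommGroup M] [Module R M]

-- An element `∑ sᵢ aᵢ` of the ideal generated by the invariants `aᵢ` which is itself invariant is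
-- `∑ sᵢ' aᵢ` with invariant `sᵢ'`, by complete reducibility.
lemma IsReductive.comap_invariants_surjective [FiniteDimensional ℂ V] {G H : Subgroup (V ≃ₗ[ℂ] V)}
    (hG : IsReductive G) (hGH : G ≤ H) [(G.subgroupOf H).FiniteIndex] :
    Function.Surjective (PrimeSpectrum.comap (invariants R M H).val.toRingHom) := by
  intro p
  rw [← Set.mem_range, PrimeSpectrum.mem_range_comap_iff]
  refine le_antisymm (fun b hb => ?_) Ideal.le_comap_map
  obtain ⟨n, s, a, hsum⟩ := Submodule.mem_span_set'.1 (Ideal.mem_comap.1 hb)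
  choose a' ha' haa' using fun i => (a i).2
  let L : (Fin n → HomAlg R V M) →ₗ[ℂ] HomAlg R V M :=
    ∑ i, LinearMap.mulRight ℂ (a' i : HomAlg R V M) ∘ₗ LinearMap.proj i
  have hL (e) : L e = ∑ i, e i * (a' i : HomAlg R V M) := by simp [L]
  have hLs : L s = b := by
    rw [hL]
    exact (Finset.sum_congr rfl fun i _ => congrArg (s i * ·) (haa' i)).trans hsum
  obtain ⟨e, he, hLe⟩ := hG.exists_invariant_of_finiteIndex hGH isLocallyRational_glRep.powRep L
    (e₀ := s) fun g hg => calc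
      L (powRep (glRep R V M) _ g s) = glAct R M g (L s) := by
        simp only [hL, powRep_apply, glRep_apply, map_sum, map_mul, (a' _).2 g hg]
      _ = L s := by rw [hLs, b.2 g hg]
  let e' (i : Fin n) : invariants R M H := ⟨e i, fun g hg => congrFun (he g hg) i⟩
  have hb : b = ∑ i, e' i * a' i := by
    refine Subtype.ext ?_
    rw [← hLs, ← hLe, hL]
    simp [e']
  rw [hb]
  exact sum_mem fun i _ => Ideal.mul_mem_left _ _ (ha' i)

end LyingOver

section Alternating

variable {R : Type*} [CommRing R] {M : Type*} [AddCommGroup M] [Module R M] {n : ℕ}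

lemma alternatingMap_eq_basis_det_smul {N : Type*} [AddCommGroup N] [Module R N]
    (e : Module.Basis (Fin n) R M) (D : M [⋀^Fin n]→ₗ[R] N) (m : Fin n → M) :
    D m = e.det m • D e := by
  suffices D = (LinearMap.toSpanSingleton R N (D e)).compAlternatingMap e.det from
    DFunLike.congr_fun this m
  refine e.ext_alternating fun v hv => ?_
  let σ : Equiv.Perm (Fin n) := Equiv.ofBijective v (Finite.injective_iff_bijective.1 hv)
  change D (e ∘ σ) = e.det (e ∘ σ) • D e
  rw [D.map_perm, e.det.map_perm, e.det_self, Units.smul_def, Units.smul_def, smul_assoc, one_smul]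

variable [IsDomain R]

lemma exists_smul_eq_sum (hM : Module.rank R M = n) {e : Fin n → M} (he : LinearIndependent R e)
    (x : M) : ∃ a : R, a ≠ 0 ∧ ∃ b : Fin n → R, a • x = ∑ i, b i • e i := by
  have hdep : ¬ LinearIndependent R (Fin.cons x e : Fin (n + 1) → M) := by
    intro h
    have hcard := h.cardinal_lift_le_rank
    rw [hM, Cardinal.mk_fin, Cardinal.lift_natCast, Cardinal.lift_natCast, Nat.cast_le] at hcard
    exact n.not_succ_le_self hcard
  obtain ⟨g, hg, i, hi⟩ := Fintype.not_linearIndependent_iff.1 hdep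
  simp only [Fin.sum_univ_succ, Fin.cons_zero, Fin.cons_succ] at hg
  refine ⟨g 0, fun h0 => hi ?_, fun i => -g i.succ, ?_⟩
  · rw [h0, zero_smul, zero_add] at hg
    exact Fin.cases h0 (Fintype.linearIndependent_iff.1 he _ hg) i
  · simp only [neg_smul, Finset.sum_neg_distrib]
    exact eq_neg_of_add_eq_zero_left hg

-- Cramer's rule: the coefficients are `c (m₁, …, x, …, mₙ)` with `x` at the `i`-th place.
lemma smul_mem_span_of_alternatingMap [Module.IsTorsionFree R M] (hM : Module.rank R M = n)
    (c : M [⋀^Fin n]→ₗ[R] R) (m : Fin n → M) (x : M) :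
    c m • x ∈ Submodule.span R (Set.range m) := by
  by_cases hc : c m = 0
  · rw [hc, zero_smul]
    exact zero_mem _
  have hm : LinearIndependent R m := by
    by_contra h
    exact hc (c.map_linearDependent m h)
  obtain ⟨a, ha, b, hb⟩ := exists_smul_eq_sum hM hm x
  have hcoef (i) : a * c (Function.update m i x) = b i * c m := by
    rw [← smul_eq_mul, ← AlternatingMap.map_update_smul, hb, AlternatingMap.map_update_sum,
      Finset.sum_eq_single i]
    · rw [AlternatingMap.map_update_smul, Function.update_eq_self, smul_eq_mul]
    · intro j _ hj
      rw [AlternatingMap.map_update_smul, AlternatingMap.map_update_self _ _ hj.symm, smul_zero]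
    · simp
  have hcramer : c m • x = ∑ i, c (Function.update m i x) • m i := by
    refine smul_right_injective M ha ?_
    calc a • c m • x = c m • a • x := smul_comm _ _ _
      _ = ∑ i, (b i * c m) • m i := by simp only [hb, Finset.smul_sum, smul_smul, mul_comm]
      _ = a • ∑ i, c (Function.update m i x) • m i := by
        simp only [← hcoef, Finset.smul_sum, smul_smul]
  rw [hcramer]
  exact sum_mem fun i _ => Submodule.smul_mem _ _ (Submodule.subset_span ⟨i, rfl⟩)

end Alternating

section DetForm

variable {R : Type} [CommRing R] [Algebra ℂ R]
variable {V : Type} [AddCommGroup V] [Module ℂ V]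
variable {M : Type} [AddCommGroup M] [Module R M]
variable {n : ℕ} (b : Module.Basis (Fin n) ℂ V)

variable (R M) in
/-- The form `m ↦ det (b i ⊗ m j)` with values in `Sym^*(V ⊗ M)`: up to the choice of the basis `b`,
the determinant of the universal homomorphism `V ⊗ O → M^∨`, paired with `m₁ ∧ ⋯ ∧ mₙ`. -/
def detForm : M [⋀^Fin n]→ₗ[R] HomAlg R V M :=
  AlternatingMap.compLinearMap
    { (Matrix.detRowAlternating (n := Fin n) (R := HomAlg R V M)).toMultilinearMap.restrictScalars R
        with
      map_eq_zero_of_eq' := fun v _ _ h hij =>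
        (Matrix.detRowAlternating (n := Fin n) (R := HomAlg R V M)).map_eq_zero_of_eq v h hij }
    (LinearMap.pi fun i => genRight (b i))

lemma detForm_apply (m : Fin n → M) :
    detForm R M b m = Matrix.det (Matrix.of fun j i => (gen (b i) (m j) : HomAlg R V M)) := rfl

lemma gen_apply_basis_eq_sum (g : V ≃ₗ[ℂ] V) (i : Fin n) (m : M) :
    (gen (g (b i)) m : HomAlg R V M)
      = ∑ k, gen (b k) m * algebraMap ℂ _ (LinearMap.toMatrix b b g k i) := by
  rw [← genLeft_apply, ← b.sum_repr (g (b i)), map_sum]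
  refine Finset.sum_congr rfl fun k _ => ?_
  rw [map_smul, Algebra.smul_def, mul_comm, genLeft_apply, LinearMap.toMatrix_apply]
  rfl

lemma glAct_detForm (g : V ≃ₗ[ℂ] V) (m : Fin n → M) :
    glAct R M g (detForm R M b m)
      = algebraMap ℂ (HomAlg R V M) (LinearEquiv.det g : ℂˣ) * detForm R M b m := by
  rw [detForm_apply, AlgHom.map_det, LinearEquiv.coe_det, ← LinearMap.det_toMatrix b,
    RingHom.map_det, mul_comm, ← Matrix.det_mul]
  congr 1
  ext j i
  exact (glAct_gen g (b i) (m j)).trans (gen_apply_basis_eq_sum b g i (m j))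

lemma changeRing_detForm {R' : Type} [CommRing R'] [Algebra ℂ R']
    {M' : Type} [AddCommGroup M'] [Module R' M'] (φ : R →ₐ[ℂ] R')
    (ψ : M →ₛₗ[(φ : R →+* R')] M') (m : Fin n → M) :
    changeRing φ ψ (detForm R M b m) = detForm R' M' b fun i => ψ (m i) := by
  rw [detForm_apply, detForm_apply, RingHom.map_det]
  congr 1
  ext j i
  simp [gen, changeRing_ι]

variable {H : Subgroup (V ≃ₗ[ℂ] V)} {N : ℕ} (hN : ∀ g ∈ H, LinearEquiv.det g ^ N = 1)

variable (R) in
/-- The products of `N` determinants, which are invariant under `H` if `det ^ N` is trivial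
on `H`. -/
def detProd (m : Fin N → Fin n → M) : invariants R M H :=
  ⟨∏ i, detForm R M b (m i), fun g hg => by
    rw [map_prod, Finset.prod_congr rfl fun i _ => glAct_detForm b g (m i), Finset.prod_mul_distrib,
      Finset.prod_const, Finset.card_univ, Fintype.card_fin, ← map_pow, ← Units.val_pow_eq_pow_val,
      hN g hg, Units.val_one, map_one, one_mul]⟩

lemma coe_detProd (m : Fin N → Fin n → M) :
    (detProd R b hN m : HomAlg R V M) = ∏ i, detForm R M b (m i) := rfl

lemma changeRingInvariants_detProd {R' : Type} [CommRing R'] [Algebra ℂ R']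
    {M' : Type} [AddCommGroup M'] [Module R' M'] (φ : R →ₐ[ℂ] R')
    (ψ : M →ₛₗ[(φ : R →+* R')] M') (m : Fin N → Fin n → M) :
    changeRingInvariants H φ ψ (detProd R b hN m) = detProd R' b hN fun i j => ψ (m i j) := by
  refine Subtype.ext ?_
  change changeRing φ ψ (∏ i, detForm R M b (m i)) = _
  rw [map_prod, coe_detProd]
  exact Finset.prod_congr rfl fun i _ => changeRing_detForm b φ ψ (m i)

lemma detProd_eq_prod_det_smul (e : Module.Basis (Fin n) R M) (m : Fin N → Fin n → M) :
    detProd R b hN m = (∏ i, e.det (m i)) • detProd R b hN fun _ => e := by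
  refine Subtype.ext ?_
  rw [Subalgebra.coe_smul, coe_detProd, coe_detProd, ← Finset.prod_smul]
  exact Finset.prod_congr rfl fun i _ => alternatingMap_eq_basis_det_smul e _ (m i)

-- Both sides are alternating in each argument, hence multiples of the determinant of `e`.
lemma algHom_detProd_mul_pow (e : Module.Basis (Fin n) R M) (τ : invariants R M H →ₐ[R] R)
    (c : M [⋀^Fin n]→ₗ[R] R) (m : Fin N → Fin n → M) :
    τ (detProd R b hN m) * c e ^ N = τ (detProd R b hN fun _ => e) * ∏ i, c (m i) := by
  have hc : ∏ i, c (m i) = (∏ i, e.det (m i)) * c e ^ N := by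
    simp_rw [alternatingMap_eq_basis_det_smul e c (m _), smul_eq_mul, Finset.prod_mul_distrib,
      Finset.prod_const, Finset.card_univ, Fintype.card_fin]
  rw [detProd_eq_prod_det_smul b hN e m, map_smul, hc, smul_eq_mul]
  ring

end DetForm

section IsomLocus

lemma exists_det_ne_zero_of_linearIndependent {K S : Type*} [Field K] {n : ℕ}
    {φ : Fin n → S → K} (hφ : LinearIndependent K φ) :
    ∃ s : Fin n → S, Matrix.det (Matrix.of fun j i => φ i (s j)) ≠ 0 := by
  obtain ⟨f, hf, -, hli⟩ := Submodule.exists_fun_fin_finrank_span_eq K (Set.range (flip φ))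
  have hn : Module.finrank K (Submodule.span K (Set.range (flip φ))) = n := by
    rw [span_flip_eq_top_iff_linearIndependent.2 hφ, finrank_top, Module.finrank_fin_fun]
  choose s hs using hf
  refine ⟨fun j => s (Fin.cast hn.symm j), ?_⟩
  rw [← isUnit_iff_ne_zero, ← Matrix.isUnit_iff_isUnit_det,
    ← Matrix.linearIndependent_rows_iff_isUnit]
  have hrow : (Matrix.of fun j i => φ i (s (Fin.cast hn.symm j))).row = f ∘ Fin.cast hn.symm :=
    funext fun j => hs _
  rw [hrow]
  exact hli.comp _ (Fin.cast_injective hn.symm)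

lemma injective_eval_of_smul_mem_span {R K M ι : Type*} [CommRing R] [CommRing K] [IsDomain K]
    [Algebra R K] [AddCommGroup M] [Module R M] {m : ι → M} {r : R} (hr : algebraMap R K r ≠ 0)
    (hspan : ∀ x : M, r • x ∈ Submodule.span R (Set.range m)) :
    Function.Injective fun (φ : M →ₗ[R] K) j => φ (m j) := by
  intro φ φ' h
  ext x
  have heq : φ (r • x) = φ' (r • x) :=
    LinearMap.eqOn_span' (Set.eqOn_range.2 h) (hspan x)
  rw [map_smul, map_smul, Algebra.smul_def, Algebra.smul_def] at heq
  exact mul_left_cancel₀ hr heq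

variable {R : Type} [CommRing R] [Algebra ℂ R]
variable {V : Type} [AddCommGroup V] [Module ℂ V]
variable {M : Type} [AddCommGroup M] [Module R M]
variable {n : ℕ} (b : Module.Basis (Fin n) ℂ V) (q : PrimeSpectrum (HomAlg R V M))

/-- The basis of `V ⊗ κ(q)` induced by a basis of `V`. -/
def residueBasis : Module.Basis (Fin n) q.asIdeal.ResidueField
    (q.asIdeal.ResidueField ⊗[R] (R ⊗[ℂ] V)) :=
  (b.baseChange R).baseChange q.asIdeal.ResidueField

lemma universalHom_residueBasis (i : Fin n) (m : M) :
    universalHom q (residueBasis b q i) m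
      = algebraMap (HomAlg R V M) q.asIdeal.ResidueField (gen (b i) m) := by
  rw [residueBasis, Module.Basis.baseChange_apply, Module.Basis.baseChange_apply,
    universalHom_tmul]

lemma detForm_mem_iff (m : Fin n → M) : detForm R M b m ∈ q.asIdeal ↔
    Matrix.det (Matrix.of fun j i => universalHom q (residueBasis b q i) (m j)) = 0 := by
  rw [← Ideal.algebraMap_residueField_eq_zero, detForm_apply, RingHom.map_det]
  simp only [universalHom_residueBasis]
  rfl

lemma exists_detForm_notMem_of_mem_isomLocus (hq : q ∈ isomLocus R V M) :
    ∃ m : Fin n → M, detForm R M b m ∉ q.asIdeal := by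
  have hli : LinearIndependent q.asIdeal.ResidueField
      (fun i (m : M) => universalHom q (residueBasis b q i) m) := by
    rw [Fintype.linearIndependent_iff]
    intro α hα
    refine Fintype.linearIndependent_iff.1 (residueBasis b q).linearIndependent α (hq.1 ?_)
    ext m
    simpa using congrFun hα m
  obtain ⟨m, hm⟩ := exists_det_ne_zero_of_linearIndependent hli
  exact ⟨m, fun h => hm ((detForm_mem_iff b q m).1 h)⟩

lemma mem_isomLocus_of_detForm_notMem {m : Fin n → M} (hm : detForm R M b m ∉ q.asIdeal) {r : R}
    (hr : algebraMap R (HomAlg R V M) r ∉ q.asIdeal)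
    (hspan : ∀ x : M, r • x ∈ Submodule.span R (Set.range m)) : q ∈ isomLocus R V M := by
  set B := Matrix.of fun j i => universalHom q (residueBasis b q i) (m j) with hB
  have hBunit : IsUnit B := by
    rwa [Matrix.isUnit_iff_isUnit_det, isUnit_iff_ne_zero, Ne, ← detForm_mem_iff]
  let ev (φ : M →ₗ[R] q.asIdeal.ResidueField) (j : Fin n) := φ (m j)
  have hev : Function.Injective ev := by
    refine injective_eval_of_smul_mem_span (fun h => hr ?_) hspan
    rwa [← Ideal.algebraMap_residueField_eq_zero, ← IsScalarTower.algebraMap_apply]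
  have hmatrix : (ev ∘ universalHom q) ∘ (residueBasis b q).equivFun.symm = B.mulVec := by
    ext α j
    simp [ev, hB, Matrix.mulVec, dotProduct, mul_comm, Module.Basis.equivFun_symm_apply]
  have hbij : Function.Bijective (ev ∘ universalHom q) := by
    rw [← Function.Bijective.of_comp_iff _ (residueBasis b q).equivFun.symm.bijective, hmatrix]
    exact ⟨Matrix.mulVec_injective_iff_isUnit.2 hBunit,
      Matrix.mulVec_surjective_iff_isUnit.2 hBunit⟩
  exact (Function.Bijective.of_comp_iff' ⟨hev, hbij.2.of_comp⟩ _).1 hbij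

lemma comap_mem_isomQuotient_iff [IsDomain R] [Module.IsTorsionFree R M]
    (hM : Module.rank R M = n) {H : Subgroup (V ≃ₗ[ℂ] V)}
    (hsurj : Function.Surjective (PrimeSpectrum.comap (invariants R M H).val.toRingHom))
    {N : ℕ} (hN0 : N ≠ 0) (hN : ∀ g ∈ H, LinearEquiv.det g ^ N = 1)
    {τ : invariants R M H →ₐ[R] R} {c : M [⋀^Fin n]→ₗ[R] R} {f : R}
    (hτ : ∀ m, τ (detProd R b hN m) = f * ∏ i, c (m i)) {p : PrimeSpectrum R} {m₀ : Fin n → M}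
    (hm₀ : c m₀ ∉ p.asIdeal) :
    PrimeSpectrum.comap τ.toRingHom p ∈ isomQuotient R M H ↔ f ∉ p.asIdeal := by
  constructor
  · rintro ⟨q, hq, hqp⟩ hf
    obtain ⟨m, hm⟩ := exists_detForm_notMem_of_mem_isomLocus b q hq
    have hmem : detProd R b hN (fun _ => m) ∈ (PrimeSpectrum.comap τ.toRingHom p).asIdeal := by
      change τ _ ∈ p.asIdeal
      rw [hτ]
      exact p.asIdeal.mul_mem_right _ hf
    rw [← hqp] at hmem
    change (detProd R b hN fun _ => m : HomAlg R V M) ∈ q.asIdeal at hmem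
    rw [coe_detProd] at hmem
    obtain ⟨-, -, hi⟩ := q.2.prod_mem_iff.1 hmem
    exact hm hi
  · intro hf
    obtain ⟨q, hqp⟩ := hsurj (PrimeSpectrum.comap τ.toRingHom p)
    have hmem (x : invariants R M H) : (x : HomAlg R V M) ∈ q.asIdeal ↔ τ x ∈ p.asIdeal :=
      SetLike.ext_iff.1 (congrArg PrimeSpectrum.asIdeal hqp) x
    refine ⟨q, mem_isomLocus_of_detForm_notMem b q (m := m₀) (fun h => ?_) (r := c m₀) (fun h => ?_)
      (smul_mem_span_of_alternatingMap hM c m₀), hqp⟩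
    · have hprod : τ (detProd R b hN fun _ => m₀) ∈ p.asIdeal := by
        rw [← hmem, coe_detProd, Finset.prod_const, Finset.card_univ, Fintype.card_fin]
        exact q.asIdeal.pow_mem_of_mem h N (Nat.pos_of_ne_zero hN0)
      rw [hτ] at hprod
      obtain ⟨i, -, hi⟩ := (p.2.prod_mem_iff).1 ((p.2.mem_or_mem hprod).resolve_left hf)
      exact hm₀ hi
    · have hc := (hmem (algebraMap R _ (c m₀))).1 h
      rw [τ.commutes] at hc
      exact hm₀ hc

end IsomLocus

section Restriction

variable {X : Scheme.{0}} {A : X.Modules} {n : ℕ}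

lemma resO_self {W : X.Opens} (f : Γ(X, W)) : resO le_rfl f = f :=
  ConcreteCategory.congr_hom (X.presheaf.map_id _) f

lemma resM_self {W : X.Opens} (x : Γ(A, W)) : resM A le_rfl x = x :=
  ConcreteCategory.congr_hom (A.presheaf.map_id _) x

lemma resM_resM {W W' W'' : X.Opens} (h : W' ≤ W) (h' : W'' ≤ W') (x : Γ(A, W)) :
    resM A h' (resM A h x) = resM A (h'.trans h) x :=
  (ConcreteCategory.congr_hom (A.presheaf.map_comp (homOfLE h).op (homOfLE h').op) x).symm

lemma resM_update {W W' : X.Opens} (h : W' ≤ W) [DecidableEq (Fin n)] (m : Fin n → Γ(A, W))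
    (i : Fin n) (x : Γ(A, W)) :
    (fun j => resM A h (Function.update m i x j))
      = Function.update (fun j => resM A h (m j)) i (resM A h x) :=
  funext fun j => Function.apply_update (fun _ => resM A h) m i x j

end Restriction

section Volume

variable {X : Scheme.{0}} {A : X.Modules} {n : ℕ}

/-- `vol` freely generates the sheaf `(⋀^n A)^∨`. -/
def AltForm.IsGenerator (vol : AltForm A n ⊤) : Prop :=
  ∀ (W : X.Opens) (ω : AltForm A n W), ∃! f : Γ(X, W), ω = (vol.restrict le_top).smul f

/-- `s` freely generates the sheaf `det A = (⋀^n A)^∨∨`. -/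
def DetSection.IsGenerator (s : DetSection A n ⊤) : Prop :=
  ∀ (W : X.Opens) (t : DetSection A n W), ∃! f : Γ(X, W),
    ∀ (W' : X.Opens) (h : W' ≤ W) (ω : AltForm A n W'),
      t.eval W' h ω = resO h f * s.eval W' le_top ω

/-- The section `m 0 ∧ ⋯ ∧ m (n - 1)` of `det A`. -/
def wedge {W : X.Opens} (m : Fin n → Γ(A, W)) : DetSection A n W where
  eval W' h ω := ω.form W' le_rfl fun i => resM A h (m i)
  add _ _ _ _ := rfl
  smul W' h f ω := congrArg (· * _) (resO_self f)
  res W' W'' h' h ω := by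
    rw [← ω.res W' W'' le_rfl h]
    simp only [resM_resM]
    rfl

/-- Restriction of a section of `det A`. -/
def DetSection.restrict {W W₁ : X.Opens} (s : DetSection A n W) (h₁ : W₁ ≤ W) :
    DetSection A n W₁ where
  eval W' h ω := s.eval W' (h.trans h₁) ω
  add W' h ω η := s.add W' (h.trans h₁) ω η
  smul W' h f ω := s.smul W' (h.trans h₁) f ω
  res W' W'' h' h ω := s.res W' W'' (h'.trans h₁) h ω

namespace DetSection.IsGenerator

variable {s : DetSection A n ⊤} (hs : s.IsGenerator)

/-- The coordinate of a section of `det A` with respect to a generator. -/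
def coord {W : X.Opens} (t : DetSection A n W) : Γ(X, W) := (hs W t).choose

lemma eval_eq {W W' : X.Opens} (t : DetSection A n W) (h : W' ≤ W) (ω : AltForm A n W') :
    t.eval W' h ω = resO h (hs.coord t) * s.eval W' le_top ω :=
  (hs W t).choose_spec.1 W' h ω

lemma coord_eq {W : X.Opens} {t : DetSection A n W} {f : Γ(X, W)}
    (h : ∀ (W' : X.Opens) (h : W' ≤ W) (ω : AltForm A n W'),
      t.eval W' h ω = resO h f * s.eval W' le_top ω) : hs.coord t = f :=
  ((hs W t).choose_spec.2 f h).symm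

lemma form_resM_eq {W W' : X.Opens} (h : W' ≤ W) (m : Fin n → Γ(A, W)) (ω : AltForm A n W') :
    ω.form W' le_rfl (fun i => resM A h (m i))
      = resO h (hs.coord (wedge m)) * s.eval W' le_top ω :=
  hs.eval_eq (wedge m) h ω

/-- The coordinates of the sections `m 0 ∧ ⋯ ∧ m (n - 1)` of `det A`, as an alternating form in
`m`. -/
def volume : AltForm A n ⊤ where
  form W _ :=
    { toFun m := hs.coord (wedge m)
      map_update_add' m i x y := hs.coord_eq fun W' h ω => by
        change ω.form _ _ (fun _ => resM A h _) = _
        rw [resM_update, map_add (resM A h), AlternatingMap.map_update_add, map_add, add_mul,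
          ← resM_update, ← resM_update, hs.form_resM_eq, hs.form_resM_eq]
      map_update_smul' m i a x := hs.coord_eq fun W' h ω => by
        change ω.form _ _ (fun _ => resM A h _) = _
        rw [resM_update, LinearMap.map_smulₛₗ, AlternatingMap.map_update_smul, ← resM_update,
          hs.form_resM_eq, smul_eq_mul, smul_eq_mul, map_mul, mul_assoc]
      map_eq_zero_of_eq' m i j hm hij := hs.coord_eq fun W' h ω => by
        rw [map_zero, zero_mul]
        exact AlternatingMap.map_eq_zero_of_eq _ _ (congrArg (resM A h) hm) hij }
  res W W' _ h m := hs.coord_eq fun W'' h' ω => by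
    change ω.form _ _ (fun _ => resM A h' _) = _
    simp only [resM_resM, resO_resO]
    exact hs.form_resM_eq _ m ω

lemma eq_smul_volume {W : X.Opens} (ω : AltForm A n W) :
    ω = (hs.volume.restrict le_top).smul (s.eval W le_top ω) := by
  ext W' h m
  have key := hs.form_resM_eq le_rfl m (ω.restrict h)
  simp only [resM_self, resO_self] at key
  rw [s.res W W' le_top h ω, mul_comm] at key
  exact key

lemma eval_smul_volume {W : X.Opens} (f : Γ(X, W)) :
    s.eval W le_top ((hs.volume.restrict le_top).smul f) = f := by
  have hone : s.eval W le_top (hs.volume.restrict le_top) = 1 := by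
    refine (hs W (s.restrict le_top)).unique (fun W' h ω => ?_) fun W' h ω => ?_
    · change s.eval W' le_top ω = _
      rw [← s.res W W' le_top h, mul_comm, ← s.smul]
      exact congrArg _ (hs.eq_smul_volume ω)
    · rw [map_one, one_mul]
      rfl
  rw [s.smul, hone, mul_one]

lemma isGenerator_volume : hs.volume.IsGenerator := fun W ω =>
  ⟨s.eval W le_top ω, hs.eq_smul_volume ω, fun f hf => by rw [hf, hs.eval_smul_volume]⟩

end DetSection.IsGenerator

lemma HasTrivialDet.exists_isGenerator (h : HasTrivialDet A n) :
    ∃ vol : AltForm A n ⊤, vol.IsGenerator :=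
  let ⟨_, hs⟩ := h
  ⟨_, DetSection.IsGenerator.isGenerator_volume hs⟩

end Volume

section Extension

variable {X : Scheme.{0}} (A : X.Modules) [A.IsQuasicoherent]

lemma exists_resM_image_eq_units_smul {R : CommRingCat.{0}} (ψ : Spec R ⟶ X) [IsOpenImmersion ψ]
    (f : R) (s : Γ(A, ψ ''ᵁ PrimeSpectrum.basicOpen f)) :
    ∃ (t : Γ(A, ψ ''ᵁ ⊤)) (u : Γ(X, ψ ''ᵁ PrimeSpectrum.basicOpen f)ˣ),
      resM A (ψ.image_mono le_top) t = (u : Γ(X, ψ ''ᵁ PrimeSpectrum.basicOpen f)) • s := by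
  let D : (Spec R).Opens := PrimeSpectrum.basicOpen f
  have hloc : IsLocalizing (modulesSpecToSheaf.obj (A.restrict ψ)) :=
    (isIso_fromTildeΓ_iff_isLocalizing (A.restrict ψ)).1 inferInstance
  obtain ⟨⟨t, ⟨_, k, rfl⟩⟩, ht⟩ := (hloc f).surj s
  have hunit : IsUnit (algebraMap R Γ(Spec R, D) (f ^ k)) := by
    rw [map_pow]
    exact (IsLocalization.Away.algebraMap_isUnit f).pow k
  exact ⟨t, (hunit.map (ψ.appIso D).inv.hom).unit, ht.symm⟩

lemma exists_resM_basicOpen_eq_units_smul {W : X.Opens} (hW : IsAffineOpen W) (f : Γ(X, W))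
    (s : Γ(A, X.basicOpen f)) : ∃ (t : Γ(A, W)) (u : Γ(X, X.basicOpen f)ˣ),
      resM A (X.basicOpen_le f) t = (u : Γ(X, X.basicOpen f)) • s := by
  -- The image of `⊤` under `hW.fromSpec` is only propositionally equal to `W`, hence the
  -- generalization to arbitrary open sets.
  suffices ∀ W₀ D₀ : X.Opens, W₀ = W → D₀ = X.basicOpen f → ∀ h : D₀ ≤ W₀,
      (∀ s : Γ(A, D₀), ∃ (t : Γ(A, W₀)) (u : Γ(X, D₀)ˣ), resM A h t = (u : Γ(X, D₀)) • s) →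
      ∀ s : Γ(A, X.basicOpen f), ∃ (t : Γ(A, W)) (u : Γ(X, X.basicOpen f)ˣ),
        resM A (X.basicOpen_le f) t = (u : Γ(X, X.basicOpen f)) • s from
    this _ _ (by simp) (hW.fromSpec_image_basicOpen f) (hW.fromSpec.image_mono le_top)
      (exists_resM_image_eq_units_smul A hW.fromSpec f) s
  rintro W₀ D₀ rfl rfl h hs
  exact hs

end Extension

section LocallyFree

variable {X : Scheme.{0}} {A : X.Modules} {n : ℕ}

/-- The restrictions of the sections `e i` form bases over all open subsets of `W`. -/
def IsSheafBasis {W : X.Opens} (e : Fin n → Γ(A, W)) : Prop :=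
  ∀ (W' : X.Opens) (h : W' ≤ W), LinearIndependent Γ(X, W') (fun i => resM A h (e i)) ∧
    Submodule.span Γ(X, W') (Set.range fun i => resM A h (e i)) = ⊤

namespace IsSheafBasis

variable {W W' W'' : X.Opens} {e : Fin n → Γ(A, W)}

lemma res (he : IsSheafBasis e) (h : W' ≤ W) : IsSheafBasis fun i => resM A h (e i) := by
  intro W'' h'
  simpa only [resM_resM] using he W'' (h'.trans h)

/-- The basis of the sections over an open subset. -/
def basis (he : IsSheafBasis e) (h : W' ≤ W) : Module.Basis (Fin n) Γ(X, W') Γ(A, W') :=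
  .mk (he W' h).1 (he W' h).2.ge

lemma basis_apply (he : IsSheafBasis e) (h : W' ≤ W) (i : Fin n) : he.basis h i = resM A h (e i) :=
  Module.Basis.mk_apply _ _ i

lemma coe_basis_self (he : IsSheafBasis e) : ⇑(he.basis le_rfl) = e :=
  funext fun i => (he.basis_apply le_rfl i).trans (resM_self (e i))

lemma basis_repr_res (he : IsSheafBasis e) (h : W' ≤ W) (h' : W'' ≤ W') (x : Γ(A, W'))
    (i : Fin n) :
    (he.basis (h'.trans h)).repr (resM A h' x) i = resO h' ((he.basis h).repr x i) := by
  have hx : resM A h' x = ∑ j, resO h' ((he.basis h).repr x j) • he.basis (h'.trans h) j := by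
    conv_lhs => rw [← (he.basis h).sum_repr x, map_sum]
    refine Finset.sum_congr rfl fun j _ => ?_
    rw [LinearMap.map_smulₛₗ, basis_apply, basis_apply, resM_resM]
  rw [hx, Module.Basis.repr_sum_self]

/-- The determinant with respect to a basis, as a section of `(⋀^n A)^∨`. -/
def det (he : IsSheafBasis e) : AltForm A n W where
  form W' h := (he.basis h).det
  res W' W'' h' h v := by
    rw [Module.Basis.det_apply, Module.Basis.det_apply, RingHom.map_det]
    congr 1
    ext i j
    exact he.basis_repr_res h' h (v j) i

lemma isUnit_form (he : IsSheafBasis e) {vol : AltForm A n ⊤} (hvol : vol.IsGenerator) :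
    IsUnit (vol.form W le_top e) := by
  obtain ⟨f, hf, -⟩ := hvol W he.det
  have hdet : (he.basis le_rfl).det = resO le_rfl f • vol.form W le_top :=
    congrFun (congrFun (congrArg AltForm.form hf) W) le_rfl
  have hone := (he.basis le_rfl).det_self
  rw [hdet, coe_basis_self, resO_self, AlternatingMap.smul_apply, smul_eq_mul] at hone
  exact IsUnit.of_mul_eq_one_right f hone

end IsSheafBasis

lemma IsTorsionFreeOfRank.exists_isSheafBasis (hA : IsTorsionFreeOfRank A n) {x : X}
    (hx : x ∈ locallyFreeLocus A) :
    ∃ (W : X.Opens) (e : Fin n → Γ(A, W)), IsAffineOpen W ∧ x ∈ W ∧ IsSheafBasis e := by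
  rw [locallyFreeLocus, TopologicalSpace.Opens.mem_sSup] at hx
  obtain ⟨W₁, ⟨k, e, he⟩, hxW₁⟩ := hx
  replace he : IsSheafBasis e := he
  obtain ⟨_, ⟨W, hW, rfl⟩, hxW, hle⟩ :=
    X.isBasis_affineOpens.exists_subset_of_mem_open hxW₁ W₁.isOpen
  have hrank := hA.rank W hW ⟨x, hxW⟩
  have : Nonempty W := ⟨⟨x, hxW⟩⟩
  rw [rank_eq_card_basis (he.basis hle), Fintype.card_fin, Nat.cast_inj] at hrank
  subst hrank
  exact ⟨W, _, hW, hxW, he.res hle⟩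

lemma notMem_primeIdealOf_iff {W : X.Opens} (hW : IsAffineOpen W) (x : W) (g : Γ(X, W)) :
    g ∉ (hW.primeIdealOf x).asIdeal ↔ x.1 ∈ X.basicOpen g := by
  rw [← PrimeSpectrum.mem_basicOpen, ← hW.fromSpec_preimage_basicOpen]
  exact iff_of_eq (congrArg (· ∈ X.basicOpen g) (hW.fromSpec_primeIdealOf x))

-- Up to units, a basis near `x` extends to sections over `W`.
lemma IsTorsionFreeOfRank.exists_form_notMem (hA : IsTorsionFreeOfRank A n)
    {vol : AltForm A n ⊤} (hvol : vol.IsGenerator) {W : X.Opens} (hW : IsAffineOpen W) (x : W)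
    (hx : x.1 ∈ locallyFreeLocus A) :
    ∃ m : Fin n → Γ(A, W), vol.form W le_top m ∉ (hW.primeIdealOf x).asIdeal := by
  have := hA.quasicoherent
  obtain ⟨W₁, e, -, hxW₁, he⟩ := hA.exists_isSheafBasis hx
  obtain ⟨f, hfle, hxf⟩ := hW.exists_basicOpen_le ⟨x.1, hxW₁⟩ x.2
  choose m u hm using fun i => exists_resM_basicOpen_eq_units_smul A hW f (resM A hfle (e i))
  have hunit : IsUnit (resO (X.basicOpen_le f) (vol.form W le_top m)) := by
    rw [← vol.res W _ le_top]
    simp only [hm]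
    rw [AlternatingMap.map_smul_univ, smul_eq_mul]
    exact (IsUnit.prod_univ_iff.2 fun i => (u i).isUnit).mul ((he.res hfle).isUnit_form hvol)
  refine ⟨m, (notMem_primeIdealOf_iff hW x _).2 ?_⟩
  have hres : X.basicOpen f ⊓ X.basicOpen (vol.form W le_top m) = X.basicOpen f :=
    (X.basicOpen_res _ (homOfLE (X.basicOpen_le f)).op).symm.trans (X.basicOpen_of_isUnit hunit)
  exact inf_eq_left.1 hres hxf

end LocallyFree

section Denominators

variable {X : Scheme.{0}}

lemma iSup_affineOpens_le (W : X.Opens) :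
    W ≤ ⨆ W' : {W' : X.Opens // W' ≤ W ∧ IsAffineOpen W'}, W'.1 := by
  intro x hx
  obtain ⟨_, ⟨W', hW', rfl⟩, hxW', hle⟩ :=
    X.isBasis_affineOpens.exists_subset_of_mem_open hx W.isOpen
  exact TopologicalSpace.Opens.mem_iSup.2 ⟨⟨W', hle, hW'⟩, hxW'⟩

lemma eq_of_resO_affine_eq {W : X.Opens} {f g : Γ(X, W)}
    (h : ∀ (W' : X.Opens) (h : W' ≤ W), IsAffineOpen W' → resO h f = resO h g) : f = g :=
  X.sheaf.eq_of_locally_eq' _ W (fun W' => homOfLE W'.2.1) (iSup_affineOpens_le W) f g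
    fun W' => h W'.1 W'.2.1 W'.2.2

lemma exists_resO_eq {W : X.Opens} {ι : Type} {U : ι → X.Opens} (hle : ∀ i, U i ≤ W)
    (hcover : W ≤ ⨆ i, U i) (φ : ∀ i, Γ(X, U i))
    (hφ : ∀ i j, resO inf_le_left (φ i) = resO (inf_le_right : U i ⊓ U j ≤ U j) (φ j)) :
    ∃ f : Γ(X, W), ∀ i, resO (hle i) f = φ i :=
  (X.sheaf.existsUnique_gluing' U W (fun i => homOfLE (hle i)) hcover φ hφ).exists

variable {W₀ W : X.Opens}

/-- The function `g` is a denominator of the rational function `a`, given on the open set `W₀`: the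
product `a * g` is regular on the open set `W` on which `g` is defined. -/
def IsDenominator (a : Γ(X, W₀)) (g : Γ(X, W)) : Prop :=
  ∃ f : Γ(X, W), resO (inf_le_left : W ⊓ W₀ ≤ W) f = resO inf_le_right a * resO inf_le_left g

lemma resO_eq_mul_of_resO_inf_eq {a : Γ(X, W₀)} {f g : Γ(X, W)}
    (hf : resO (inf_le_left : W ⊓ W₀ ≤ W) f = resO inf_le_right a * resO inf_le_left g)
    {D : X.Opens} (h : D ≤ W) (h₀ : D ≤ W₀) : resO h f = resO h₀ a * resO h g := by
  simpa only [map_mul, resO_resO] using congrArg (resO (le_inf h h₀)) hf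

variable [IsIntegral X] [hW₀ : Nonempty W₀]

lemma resO_inf_injective : Function.Injective (resO (inf_le_left : W ⊓ W₀ ≤ W)) := by
  obtain hW | hW := (W : Set X).eq_empty_or_nonempty
  · obtain rfl : W = ⊥ := TopologicalSpace.Opens.ext hW
    exact Function.injective_of_subsingleton _
  · have hne := nonempty_preirreducible_inter W.isOpen W₀.isOpen hW
      (Set.nonempty_coe_sort.1 hW₀)
    have : Nonempty (W ⊓ W₀ : X.Opens) := hne.to_subtype
    exact map_injective_of_isIntegral X _

lemma isDenominator_of_affine {a : Γ(X, W₀)} {g : Γ(X, W)}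
    (h : ∀ (W' : X.Opens) (h : W' ≤ W), IsAffineOpen W' → IsDenominator a (resO h g)) :
    IsDenominator a g := by
  let ι := {W' : X.Opens // W' ≤ W ∧ IsAffineOpen W'}
  choose φ hφ using fun i : ι => h i.1 i.2.1 i.2.2
  obtain ⟨f, hf⟩ := exists_resO_eq (fun i : ι => i.2.1) (iSup_affineOpens_le W) φ fun i j => by
    refine resO_inf_injective (W₀ := W₀) ?_
    have hi := resO_eq_mul_of_resO_inf_eq (hφ i)
      (inf_le_left.trans inf_le_left : i.1 ⊓ j.1 ⊓ W₀ ≤ i.1) inf_le_right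
    have hj := resO_eq_mul_of_resO_inf_eq (hφ j)
      (inf_le_left.trans inf_le_right : i.1 ⊓ j.1 ⊓ W₀ ≤ j.1) inf_le_right
    rw [resO_resO, resO_resO, hi, hj, resO_resO, resO_resO]
  refine ⟨f, eq_of_resO_affine_eq fun D hD hDaff => ?_⟩
  have hφD := resO_eq_mul_of_resO_inf_eq (hφ ⟨D, hD.trans inf_le_left, hDaff⟩) le_rfl
    (hD.trans inf_le_right)
  rw [← hf, resO_resO, resO_resO] at hφD
  rw [map_mul, resO_resO, resO_resO, resO_resO, hφD]

variable {A : X.Modules} {n : ℕ}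

lemma AltForm.exists_of_isDenominator {a : Γ(X, W₀)} (η : AltForm A n W)
    (h : ∀ (W' : X.Opens) (h : W' ≤ W) (m : Fin n → Γ(A, W')), IsDenominator a (η.form W' h m)) :
    ∃ ω : AltForm A n W, ∀ (W' : X.Opens) (h : W' ≤ W) (m : Fin n → Γ(A, W')),
      resO (inf_le_left : W' ⊓ W₀ ≤ W') (ω.form W' h m)
        = resO inf_le_right a * resO inf_le_left (η.form W' h m) := by
  choose φ hφ using h
  refine ⟨{
    form W' h :=
      { toFun := φ W' h
        map_update_add' m i x y := resO_inf_injective (W₀ := W₀) ?_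
        map_update_smul' m i c x := resO_inf_injective (W₀ := W₀) ?_
        map_eq_zero_of_eq' m i j hm hij := resO_inf_injective (W₀ := W₀) ?_ }
    res W' W'' h' h m := resO_inf_injective (W₀ := W₀) ?_ }, hφ⟩
  · rw [map_add, hφ, hφ, hφ, AlternatingMap.map_update_add, map_add, mul_add]
  · rw [smul_eq_mul, map_mul, hφ, hφ, AlternatingMap.map_update_smul, smul_eq_mul, map_mul,
      mul_left_comm]
  · rw [hφ, AlternatingMap.map_eq_zero_of_eq _ _ hm hij, map_zero, mul_zero]
  · have key := resO_eq_mul_of_resO_inf_eq (hφ W' h' m) (inf_le_left.trans h : W'' ⊓ W₀ ≤ W')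
      inf_le_right
    refine (hφ W'' (h.trans h') _).trans (Eq.trans ?_ (key.symm.trans (resO_resO _ _ _).symm))
    rw [η.res W' W'' h' h, resO_resO]

-- The regular form `a * c • vol` is a multiple `f • vol`, and `f` is the extension of `a * c`.
lemma AltForm.IsGenerator.isDenominator {vol : AltForm A n ⊤} (hvol : vol.IsGenerator)
    {a : Γ(X, W₀)} {c : Γ(X, W)}
    (h : ∀ (W' : X.Opens) (h : W' ≤ W) (m : Fin n → Γ(A, W')),
      IsDenominator a (resO h c * vol.form W' le_top m)) : IsDenominator a c := by
  obtain ⟨ω, hω⟩ := ((vol.restrict le_top).smul c).exists_of_isDenominator h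
  obtain ⟨f, hf, -⟩ := hvol W ω
  refine ⟨f, (hvol (W ⊓ W₀) (ω.restrict inf_le_left)).unique ?_ ?_⟩
  · rw [hf]
    ext W' h' m
    change resO _ f * _ = resO h' (resO inf_le_left f) * _
    rw [resO_resO]
    rfl
  · ext W' h' m
    apply resO_inf_injective (W₀ := W₀)
    refine (hω W' _ m).trans ?_
    change _ * resO _ (resO _ c * _) = resO _ (resO h' (_ * _) * _)
    simp only [map_mul, resO_resO, mul_assoc]
    rfl

lemma AltForm.IsGenerator.isDenominator_one {vol : AltForm A n ⊤} (hvol : vol.IsGenerator)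
    {a : Γ(X, W₀)} {N : ℕ} (h : ∀ (W : X.Opens) (m : Fin N → Fin n → Γ(A, W)),
      IsDenominator a (∏ i, vol.form W le_top (m i))) : IsDenominator a (1 : Γ(X, ⊤)) := by
  induction N with
  | zero => simpa using h ⊤ finZeroElim
  | succ N ih =>
    refine ih fun W m => hvol.isDenominator fun W' h' m₀ => ?_
    have key := h W' (Fin.cons m₀ fun i j => resM A h' (m i j))
    simp only [Fin.prod_univ_succ, Fin.cons_zero, Fin.cons_succ] at key
    rw [map_prod, mul_comm]
    simpa only [← vol.res W W' le_top h'] using key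

end Denominators

namespace SingularPrincipalBundle

variable {X : Scheme.{0}} [X.Over (Spec (CommRingCat.of ℂ))]
variable {V : Type} [AddCommGroup V] [Module ℂ V] {H : Subgroup (V ≃ₗ[ℂ] V)}
variable (B : SingularPrincipalBundle X H)

section DetProd

variable (b : Module.Basis (Fin (Module.finrank ℂ V)) ℂ V)
variable {N : ℕ} (hN : ∀ g ∈ H, LinearEquiv.det g ^ N = 1)

lemma τ_detProd_res {W W' : X.Opens} (hW : IsAffineOpen W) (hW' : IsAffineOpen W') (h : W' ≤ W)
    (m : Fin N → Fin (Module.finrank ℂ V) → Γ(B.A, W)) :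
    B.τ W' hW' (detProd _ b hN fun i j => resM B.A h (m i j))
      = resO h (B.τ W hW (detProd _ b hN m)) := by
  rw [← B.τ_res W W' hW hW' h]
  exact congrArg _ (changeRingInvariants_detProd b hN (resAlg h) (resM B.A h) m).symm

variable {vol : AltForm B.A (Module.finrank ℂ V) ⊤}

lemma exists_τ_detProd_eq_inf (hvol : vol.IsGenerator) {W₀ : X.Opens} (hW₀ : IsAffineOpen W₀)
    {e : Fin (Module.finrank ℂ V) → Γ(B.A, W₀)} (he : IsSheafBasis e) :
    ∃ a : Γ(X, W₀), ∀ (W : X.Opens) (hW : IsAffineOpen W)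
      (m : Fin N → Fin (Module.finrank ℂ V) → Γ(B.A, W)),
      resO (inf_le_left : W ⊓ W₀ ≤ W) (B.τ W hW (detProd _ b hN m))
        = resO inf_le_right a * resO inf_le_left (∏ i, vol.form W le_top (m i)) := by
  obtain ⟨u, hu⟩ := (he.isUnit_form hvol).pow N
  refine ⟨B.τ W₀ hW₀ (detProd _ b hN fun _ => e) * ↑u⁻¹, fun W hW m => ?_⟩
  refine eq_of_resO_affine_eq fun D hD hDaff => ?_
  have hD₀ : D ≤ W₀ := hD.trans inf_le_right
  have hDW : D ≤ W := hD.trans inf_le_left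
  have key := algHom_detProd_mul_pow b hN ((he.res hD₀).basis le_rfl) (B.τ D hDaff)
    (vol.form D le_top) fun i j => resM B.A hDW (m i j)
  rw [IsSheafBasis.coe_basis_self, B.τ_detProd_res b hN hW hDaff hDW,
    B.τ_detProd_res b hN hW₀ hDaff hD₀ fun _ => e, vol.res W₀ D le_top, ← map_pow, ← hu] at key
  simp only [vol.res W D le_top, ← map_prod] at key
  have hinv : resO hD₀ ↑u * resO hD₀ ↑u⁻¹ = 1 := by rw [← map_mul, u.mul_inv, map_one]
  simp only [map_mul, resO_resO]
  linear_combination resO hD₀ ↑u⁻¹ * key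
    - resO hDW (B.τ W hW (detProd _ b hN m)) * hinv

lemma exists_τ_detProd_eq [IsIntegral X] (hvol : vol.IsGenerator)
    (hU : (B.U : Set X).Nonempty) :
    ∃ f : Γ(X, ⊤), ∀ (W : X.Opens) (hW : IsAffineOpen W)
      (m : Fin N → Fin (Module.finrank ℂ V) → Γ(B.A, W)),
      B.τ W hW (detProd _ b hN m) = resO le_top f * ∏ i, vol.form W le_top (m i) := by
  obtain ⟨x₀, hx₀⟩ := hU
  obtain ⟨W₀, e, hW₀, hx₀W₀, he⟩ := B.torsionFree.exists_isSheafBasis hx₀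
  have : Nonempty W₀ := ⟨⟨x₀, hx₀W₀⟩⟩
  obtain ⟨a, ha⟩ := B.exists_τ_detProd_eq_inf b hN hvol hW₀ he
  obtain ⟨f, hf⟩ := hvol.isDenominator_one (a := a) (N := N) fun W m =>
    isDenominator_of_affine fun W' h hW' => by
      refine ⟨_, (ha W' hW' fun i j => resM B.A h (m i j)).trans ?_⟩
      simp only [vol.res W W' le_top, map_prod]
  refine ⟨f, fun W hW m => resO_inf_injective (W₀ := W₀) ?_⟩
  have hfW := resO_eq_mul_of_resO_inf_eq hf le_top (inf_le_right : W ⊓ W₀ ≤ W₀)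
  rw [map_one, mul_one] at hfW
  rw [ha, map_mul, resO_resO, hfW]

end DetProd

lemma exists_σ_mem_isomQuotient_iff [IsIntegral X] [FiniteDimensional ℂ V] {N : ℕ} (hN0 : N ≠ 0)
    (hN : ∀ g ∈ H, LinearEquiv.det g ^ N = 1)
    (hsurj : ∀ W : X.Opens, Function.Surjective
      (PrimeSpectrum.comap (invariants Γ(X, W) Γ(B.A, W) H).val.toRingHom)) :
    ∃ f : Γ(X, ⊤), ∀ (W : X.Opens) (hW : IsAffineOpen W), W ≤ B.U → ∀ x : W,
      B.σ hW x ∈ isomQuotient Γ(X, W) Γ(B.A, W) H ↔ x.1 ∈ X.basicOpen f := by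
  rcases (B.U : Set X).eq_empty_or_nonempty with hU | hU
  · exact ⟨0, fun W _ hWU x => absurd (hWU x.2) (Set.eq_empty_iff_forall_notMem.1 hU x.1)⟩
  obtain ⟨vol, hvol⟩ := B.trivialDet.exists_isGenerator
  obtain ⟨f, hf⟩ := B.exists_τ_detProd_eq (Module.finBasis ℂ V) hN hvol hU
  refine ⟨f, fun W hW hWU x => ?_⟩
  have : Nonempty W := ⟨x⟩
  have := B.torsionFree.torsionFree W hW
  obtain ⟨m, hm⟩ := B.torsionFree.exists_form_notMem hvol hW x (hWU x.2)
  have hx : x.1 ∈ X.basicOpen (resO (le_top : W ≤ ⊤) f) ↔ x.1 ∈ X.basicOpen f := by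
    change _ ∈ X.basicOpen (X.presheaf.map (homOfLE le_top).op f) ↔ _
    rw [X.basicOpen_res]
    exact and_iff_right x.2
  rw [← hx, ← notMem_primeIdealOf_iff hW]
  exact comap_mem_isomQuotient_iff _ (B.torsionFree.rank W hW ⟨x.1, x.2⟩) (hsurj W) hN0 hN
    (hf W hW) hm

end SingularPrincipalBundle

end SingularBundle

end

theorem mainTheorem12_general
    (X : Scheme.{0}) [X.Over (Spec (CommRingCat.of ℂ))] [IsIntegral X]
    [UniversallyClosed (X ↘ Spec (CommRingCat.of ℂ))]
    (V : Type) [AddCommGroup V] [Module ℂ V] [FiniteDimensional ℂ V]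
    (G : Subgroup (V ≃ₗ[ℂ] V)) (hG : SingularBundle.IsReductive G)
    (W : Type) [AddCommGroup W] [Module ℂ W]
    (κ : Representation ℂ (V ≃ₗ[ℂ] V) W) (w₀ : W)
    (hκ : SingularBundle.IsOrbitEmbedding G κ w₀)
    (B : SingularBundle.SingularPrincipalBundle X (SingularBundle.stabilizerGL κ w₀)) :
    B.IsHonest ∨ B.AvoidsIsom := by
  obtain ⟨N, hN0, hN⟩ := hκ.exists_det_pow_eq_one
  have := hκ.finiteIndex
  obtain ⟨f, hf⟩ := B.exists_σ_mem_isomQuotient_iff hN0 hN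
    fun _ => hG.comap_invariants_surjective hκ.le_stabilizerGL
  rcases eq_or_ne f 0 with rfl | hf0
  · refine Or.inr fun U hU hUB x hx => ?_
    rw [hf U hU hUB, Scheme.basicOpen_zero] at hx
    exact hx
  · refine Or.inl fun U hU hUB x => (hf U hU hUB x).2 ?_
    obtain ⟨g, hg⟩ :=
      (isField_of_universallyClosed ℂ (X ↘ Spec (CommRingCat.of ℂ))).mul_inv_cancel hf0
    rw [X.basicOpen_of_isUnit (.of_mul_eq_one g hg)]
    exact TopologicalSpace.Opens.mem_top _

theorem mainTheorem12
    (X : Scheme.{0}) [X.Over (Spec (CommRingCat.of ℂ))] [IsIntegral X]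
    [IsProper (X ↘ Spec (CommRingCat.of ℂ))] [Smooth (X ↘ Spec (CommRingCat.of ℂ))]
    (V : Type) [AddCommGroup V] [Module ℂ V] [FiniteDimensional ℂ V]
    (G : Subgroup (V ≃ₗ[ℂ] V)) (hG : SingularBundle.IsReductive G)
    (W : Type) [AddCommGroup W] [Module ℂ W] [FiniteDimensional ℂ W]
    (κ : Representation ℂ (V ≃ₗ[ℂ] V) W) (w₀ : W)
    (hκ : SingularBundle.IsOrbitEmbedding G κ w₀)
    (B : SingularBundle.SingularPrincipalBundle X (SingularBundle.stabilizerGL κ w₀)) :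
    B.IsHonest ∨ B.AvoidsIsom :=
  mainTheorem12_general X V G hG W κ w₀ hκ B
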